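/- Let $N$ be a finite non-empty set of $n$ agents and $M$ a finite set of $m$ indivisible goods, and let every agent $i\in N$ have an additive valuation $v_i:2^M\to\mathbb R_{\ge 0}$, i.e. $v_i(X)=\sum_{g\in X}v_i(\{g\})$ for all $X\subseteq M$. Suppose that the instance is ordered: the goods can be enumerated as $g_1,\dots,g_m$ such that $v_i(\{g_1\})\ge v_i(\{g_2\})\ge\dots\ge v_i(\{g_m\})$ for every agent $i$. For $d\ge 1$ let $$\mu_i^d=\max_{(P_1,\dots,P_d)}\ \min_{1\le j\le d} v_i(P_j),$$ where the maximum is over all partitions of $M$ into $d$ (possibly empty) bundles. Then there is a complete allocation $(A_i)_{i\in N}$, i.e. a partition of $M$ into (possibly empty) bundles, one for each agent, such that 1. it is 1-out-of-$4\lceil n/3\rceil$ MMS: $v_i(A_i)\ge \mu_i^{4\lceil n/3\rceil}$ for every agent $i$; and 2. it is EF1: for all agents $i\ne j$, either $v_i(A_i)\ge v_i(A_j)$, or there is a good $g\in A_j$ with $v_i(A_i)\ge v_i(A_j\setminus\{g\})$. -/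

import Mathlib

namespace FairDivision

/-- An instance of fair division with agents `N` and indivisible goods `M`: every agent has a
nonnegative additive valuation of the bundles (finite sets) of goods. -/
structure Instance (N M : Type*) where
  /-- the value that an agent gives to a bundle -/
  v : N → Finset M → ℝ
  nonneg : ∀ i X, 0 ≤ v i X
  additive : ∀ i X, v i X = ∑ g ∈ X, v i {g}

variable {N M : Type*}

/-- The family of bundles `A` partitions the set of all goods: every good lies in exactly one
bundle. Bundles may be empty. A complete allocation is such a family indexed by the agents. -/
def IsPartition {ι : Type*} (A : ι → Finset M) : Prop :=
  ∀ g : M, ∃! j : ι, g ∈ A j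

namespace Instance

/-- All agents agree on an ordering `g₁, …, g_m` of the goods from the most valuable to the
least valuable one. -/
def IsOrdered [Fintype M] (I : Instance N M) : Prop :=
  ∃ e : Fin (Fintype.card M) ≃ M, ∀ (i : N) (k l : Fin (Fintype.card M)), k ≤ l →
    I.v i {e l} ≤ I.v i {e k}

/-- The values `min_j v_i(A_j)`, where `A` runs through the partitions of the goods into `d`
bundles. -/
def minValues (I : Instance N M) (d : ℕ) (i : N) : Set ℝ :=
  {x | ∃ A : Fin d → Finset M, IsPartition A ∧ IsLeast (Set.range fun j => I.v i (A j)) x}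

/-- The 1-out-of-`d` maximin share of agent `i`. For `d > 0` and finitely many goods the
supremum is a maximum, see `isGreatest_mms`. -/
noncomputable def mms (I : Instance N M) (d : ℕ) (i : N) : ℝ :=
  sSup (I.minValues d i)

theorem isGreatest_mms [Finite M] (I : Instance N M) {d : ℕ} (hd : 0 < d) (i : N) :
    IsGreatest (I.minValues d i) (I.mms d i) := by
  classical
  have := Fintype.ofFinite M
  have : Nonempty (Fin d) := ⟨⟨0, hd⟩⟩
  have hfin : (I.minValues d i).Finite := by
    refine (Set.finite_range fun X : Finset M => I.v i X).subset ?_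
    rintro x ⟨A, -, ⟨j, rfl⟩, -⟩
    exact ⟨A j, rfl⟩
  have hne : (I.minValues d i).Nonempty := by
    let A : Fin d → Finset M := fun j => if j = ⟨0, hd⟩ then Finset.univ else ∅
    have hA : IsPartition A := fun g =>
      ⟨⟨0, hd⟩, by simp [A], fun j hj => by
        by_contra h
        simp [A, h] at hj⟩
    obtain ⟨j, hj⟩ := Finite.exists_min fun j => I.v i (A j)
    exact ⟨I.v i (A j), A, hA, ⟨j, rfl⟩, by rintro _ ⟨k, rfl⟩; exact hj k⟩
  exact ⟨hne.csSup_mem hfin, fun x hx => le_csSup hfin.bddAbove hx⟩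

/-- The allocation `A` gives every agent at least her 1-out-of-`d` maximin share. -/
def IsOneOutOfMMS (I : Instance N M) (d : ℕ) (A : N → Finset M) : Prop :=
  ∀ i, I.mms d i ≤ I.v i (A i)

/-- The allocation `A` is envy-free up to one good. -/
def IsEF1 [DecidableEq M] (I : Instance N M) (A : N → Finset M) : Prop :=
  ∀ i j, i ≠ j →
    I.v i (A j) ≤ I.v i (A i) ∨ ∃ g ∈ A j, I.v i (A j \ {g}) ≤ I.v i (A i)

end Instance

end FairDivision

/-! Number the goods from 0 in decreasing value, pad them with worthless goods to at least `2n`, and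
let the bags start as `{t, 2n-1-t}`, `t < n`. In bag filling, a good enters an unassigned bag only
while nobody wants that bag: agents without a bag value it below their share, the others do not envy
it. An agent who wants it takes it and gives up any former bag. So each nonempty bag is unwanted
once its last good is removed; when all agents have bags, the partial allocation is EF1 and meets
the shares, and envy-cycle elimination allots the remaining goods.

If the process is stuck, some agent without a bag values a free bag below her share, while all goods
from `2n` on lie in bags. Scale her share partition to `d` bins of size exactly 1
(`exists_full_packing`). Only `4n ≤ 3d` is needed for the contradiction in `not_stuck`. Let `1 - σ`
be the size of the smallest initial bag. If `σ ≥ 1/3`, every bag has size at most `4/3` and one has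
less than 1, so the total is below `d`. Otherwise allow `1 + σ` per bag. Only initial bags above `1
+ σ` and later items of size at least `σ` can create excess, at most `n ≤ 3(d-n)` of them, and
`sum_excess_le` bounds their excess by `(d-n)(1-3σ)`: again the total is below `d`.

That bound is clear if no excess is above the mean `(1-3σ)/3`. Otherwise take the maximal block of
consecutive big bags around a heavy one (or the initial block, if only a later item is heavy). The
first items of these bags lie in distinct bins. Their partners use the free space of those bins
(`sum_sub_le`) or lie in the few other bins, where counting items per bin limits them
(`exists_sum_le`, `sum_le_of_bins`). -/

namespace FairDivision

open Finset

/-! ### Packings and the bins of the largest items -/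

/-- A nonincreasing sequence of nonnegative sizes of `L` items, packed into `d` bins so that the
total size in every bin is at most one. -/
structure Packing (d L : ℕ) (a : ℕ → ℝ) (c : ℕ → Fin d) : Prop where
  antitone : Antitone a
  nonneg : ∀ i, 0 ≤ a i
  sum_le : ∀ j, ∑ i ∈ range L with c i = j, a i ≤ 1

namespace Packing

variable {d L n lo hi : ℕ} {a : ℕ → ℝ} {c : ℕ → Fin d}

theorem sum_le_one (h : Packing d L a c) {S : Finset ℕ} (hS : S ⊆ range L) {j : Fin d}
    (hj : ∀ k ∈ S, c k = j) : ∑ k ∈ S, a k ≤ 1 := by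
  refine le_trans (sum_le_sum_of_subset_of_nonneg ?_ fun i _ _ => h.nonneg i) (h.sum_le j)
  intro k hk
  exact mem_filter.2 ⟨hS hk, hj k hk⟩

theorem le_one (h : Packing d L a c) {i : ℕ} (hi : i < L) : a i ≤ 1 := by
  have := h.sum_le_one (S := {i}) (by simpa using hi) (j := c i) (by simp)
  simpa using this

theorem ne_of_one_lt (h : Packing d L a c) {i k : ℕ} (hi : i < L) (hk : k < L) (hik : i ≠ k)
    (hlt : 1 < a i + a k) : c i ≠ c k := by
  intro hc
  have := h.sum_le_one (S := {i, k}) (by intro x hx; simp at hx; rcases hx with rfl | rfl <;> simpa)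
    (j := c k) (by intro x hx; simp at hx; rcases hx with rfl | rfl <;> simp [hc])
  rw [sum_pair hik] at this
  linarith

/-- The first `hi` items lie in different bins, apart from the items up to `2 * n - hi`. -/
theorem head_ne (h : Packing d L a c) (hL : 2 * n ≤ L) (hhi : hi ≤ n)
    (hsep : hi ≠ 0 → 1 < a (hi - 1) + a (2 * n - hi)) {r k : ℕ} (hr : r < hi) (hrk : r ≠ k)
    (hk : k ≤ 2 * n - hi) : c r ≠ c k := by
  refine h.ne_of_one_lt (by omega) (by omega) hrk ?_
  have h1 := h.antitone (show r ≤ hi - 1 by omega)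
  have h2 := h.antitone hk
  have := hsep (by omega)
  linarith

theorem card_head (h : Packing d L a c) (hL : 2 * n ≤ L) (hhi : hi ≤ n)
    (hsep : hi ≠ 0 → 1 < a (hi - 1) + a (2 * n - hi)) : ((range hi).image c).card = hi := by
  rw [card_image_of_injOn, card_range]
  intro r hr k hk hrk
  by_contra hne
  simp at hr hk
  exact h.head_ne hL hhi hsep hr hne (by omega) hrk

/-- The items `2 * n - 1 - i` with `lo ≤ i < hi` and possibly some smaller ones, `X`, that lie in
the bins of the items `i` themselves are paid for by the free space `1 - a i` of those bins. -/
theorem sum_sub_le (h : Packing d L a c) (hL : 2 * n ≤ L) (hhi : hi ≤ n) (hlo : lo ≤ hi)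
    (hsep : hi ≠ 0 → 1 < a (hi - 1) + a (2 * n - hi))
    (hblock : ∀ i ∈ Ico lo hi, 1 < a i + a (2 * n - 1 - i))
    {X : Finset ℕ} (hX : X ⊆ Ico (2 * n) L) (hXlo : lo ≠ 0 → X = ∅) {σ δ : ℝ} (hσ : 0 ≤ σ)
    (hδ : 0 ≤ δ) (hXδ : X = ∅ ∨ δ = 0) (hδi : ∀ i ∈ Ico lo hi, δ ≤ 1 - a i) :
    ∑ k ∈ Ico (2 * n - hi) (2 * n - lo) ∪ X, (a k - σ) - ∑ i ∈ Ico lo hi, (1 - a i) ≤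
      ∑ k ∈ Ico (2 * n - hi) (2 * n - lo) ∪ X with c k ∉ (range hi).image c, (a k - σ - δ) := by
  set Ω := Ico (2 * n - hi) (2 * n - lo) ∪ X with hΩ
  have hΩL : Ω ⊆ range L := by
    intro k hk
    simp only [hΩ, mem_union, mem_Ico] at hk
    rcases hk with hk | hk
    · simp; omega
    · have := hX hk; simp at this; simp; omega
  -- There are as many partners as block items, unless `δ = 0`. Hence lowering every `a k - σ` and
  -- every `1 - a i` by `δ` does not change the difference of the two sums.
  have hcard : (Ω.card : ℝ) * δ = ((Ico lo hi).card : ℝ) * δ := by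
    rcases hXδ with h0 | h0
    · congr 2
      rw [hΩ, h0, union_empty, Nat.card_Ico, Nat.card_Ico]; omega
    · simp [h0]
  -- A partner `k` cannot share a bin with an item `r` before the block: `a r` is at least the size
  -- of the block item paired with `k`, and that pair already exceeds 1.
  have hin : ∀ k ∈ Ω, c k ∈ (range hi).image c → c k ∈ (Ico lo hi).image c := by
    intro k hk hc
    obtain ⟨r, hr, hrk⟩ := mem_image.1 hc
    refine mem_image.2 ⟨r, ?_, hrk⟩
    rw [mem_Ico]
    refine ⟨?_, by simpa using hr⟩
    by_contra! hlt
    have hk' : k ∈ Ico (2 * n - hi) (2 * n - lo) := by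
      rw [hΩ, hXlo (by omega), union_empty] at hk; exact hk
    rw [mem_Ico] at hk'
    have h1 := hblock (2 * n - 1 - k) (by rw [mem_Ico]; omega)
    rw [show 2 * n - 1 - (2 * n - 1 - k) = k by omega] at h1
    have h2 := h.antitone (show r ≤ 2 * n - 1 - k by omega)
    exact h.ne_of_one_lt (by omega) (by omega) (by omega) (by linarith) hrk
  have hinj : Set.InjOn c (Ico lo hi : Finset ℕ) := by
    intro r hr k hk hrk
    by_contra hne
    simp at hr hk
    exact h.head_ne hL hhi hsep hr.2 hne (by omega) hrk
  -- If the bin of `i` contains items of `Ω`, they fit into `1 - a i` and at least one of them is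
  -- lowered by `δ`; if not, `δ ≤ 1 - a i` is what is needed.
  have key : ∀ i ∈ Ico lo hi, ∑ k ∈ Ω with c k = c i, (a k - σ - δ) ≤ 1 - a i - δ := by
    intro i hi'
    have hi2 := mem_Ico.1 hi'
    rcases (Ω.filter fun k => c k = c i).eq_empty_or_nonempty with he | hne
    · rw [he, sum_empty]; linarith [hδi i hi']
    · have hiΩ : i ∉ Ω.filter fun k => c k = c i := by
        intro hmem
        have := (mem_filter.1 hmem).1
        simp only [hΩ, mem_union, mem_Ico] at this
        rcases this with hk | hk
        · omega
        · have := hX hk; simp at this; omega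
      have h1 := h.sum_le_one (S := insert i (Ω.filter fun k => c k = c i)) (j := c i) (by
        intro k hk
        rcases mem_insert.1 hk with rfl | hk
        · simp; omega
        · exact hΩL (mem_filter.1 hk).1) (by
        intro k hk
        rcases mem_insert.1 hk with rfl | hk
        · rfl
        · exact (mem_filter.1 hk).2)
      rw [sum_insert hiΩ] at h1
      rw [sum_sub_distrib, sum_sub_distrib, sum_const, sum_const, nsmul_eq_mul, nsmul_eq_mul]
      have h2 : (1 : ℝ) ≤ ((Ω.filter fun k => c k = c i).card : ℝ) := by
        exact_mod_cast hne.card_pos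
      nlinarith
  have hsplit : ∑ k ∈ Ω, (a k - σ - δ) =
      ∑ k ∈ Ω with c k ∉ (range hi).image c, (a k - σ - δ) +
      ∑ i ∈ Ico lo hi, ∑ k ∈ Ω with c k = c i, (a k - σ - δ) := by
    rw [← sum_filter_not_add_sum_filter Ω (fun k => c k ∈ (range hi).image c)]
    congr 1
    rw [← sum_image (f := fun j => ∑ k ∈ Ω with c k = j, (a k - σ - δ)) hinj]
    rw [sum_fiberwise_eq_sum_filter]
    refine sum_congr (filter_congr fun k hk => ⟨hin k hk, fun hk' => ?_⟩) fun _ _ => rfl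
    obtain ⟨r, hr, hrk⟩ := mem_image.1 hk'
    exact mem_image.2 ⟨r, by simp at hr ⊢; omega, hrk⟩
  have h3 := sum_le_sum key
  have h4 : ∑ k ∈ Ω, (a k - σ - δ) = ∑ k ∈ Ω, (a k - σ) - Ω.card * δ := by
    rw [sum_sub_distrib, sum_const, nsmul_eq_mul]
  have h5 : ∑ i ∈ Ico lo hi, (1 - a i - δ) = ∑ i ∈ Ico lo hi, (1 - a i) - (Ico lo hi).card * δ := by
    rw [sum_sub_distrib, sum_const, nsmul_eq_mul]
  linarith

/-- The items in bins with at least three items of `K ∪ T`, where `T` is the set of the items from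
`hi` to `2 * n - hi` and `K` is a set of smaller items, in bins other than those of the first `hi`
items: there are `τ` such bins, which have `q` items, and this bounds the total size of `K`. -/
theorem exists_sum_le (h : Packing d L a c) (hL : 2 * n ≤ L) (hhi : hi ≤ n) (hnd : n ≤ d)
    (hsep : hi ≠ 0 → 1 < a (hi - 1) + a (2 * n - hi))
    {K : Finset ℕ} (hK : K ⊆ range L) (hKc : ∀ k ∈ K, c k ∉ (range hi).image c)
    (hKhi : ∀ k ∈ K, 2 * n - hi ≤ k) {ρ y : ℝ} (hρ : 0 ≤ ρ)
    (hy : ∀ k ∈ K, a k - ρ ≤ y) (hyT : ∀ k ∈ Ico hi (2 * n - hi), y ≤ a k - ρ) :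
    ∃ τ q : ℕ, 3 * τ ≤ q ∧ K.card + 2 * τ ≤ q + 2 * (d - n) ∧
      ∑ k ∈ K, (a k - ρ) ≤ τ * (1 - 3 * ρ) + (K.card - q) * y := by
  set T := Ico hi (2 * n - hi) with hT
  have hTc : ∀ k ∈ T, c k ∉ (range hi).image c := by
    intro k hk hc
    rw [hT, mem_Ico] at hk
    obtain ⟨r, hr, hrk⟩ := mem_image.1 hc
    have hr' := mem_range.1 hr
    exact h.head_ne hL hhi hsep hr' (by omega) (by omega) hrk
  have hTL : T ⊆ range L := by intro k hk; rw [hT, mem_Ico] at hk; simp; omega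
  have hdis : Disjoint K T := by
    rw [disjoint_left]; intro k hk hk'
    have := hKhi k hk; rw [hT, mem_Ico] at hk'; omega
  set U := K ∪ T with hU
  have hUL : U ⊆ range L := union_subset hK hTL
  set Q := (univ : Finset (Fin d)) \ (range hi).image c with hQ
  have hQcard : Q.card + hi = d := by
    have h1 := card_sdiff_add_card_eq_card (subset_univ ((range hi).image c))
    rw [h.card_head hL hhi hsep, card_univ, Fintype.card_fin] at h1
    exact h1
  have hUQ : ∀ k ∈ U, c k ∈ Q := by
    intro k hk
    rw [hQ, mem_sdiff]
    refine ⟨mem_univ _, ?_⟩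
    rcases mem_union.1 hk with hk | hk
    exacts [hKc k hk, hTc k hk]
  set B := Q.filter fun j => 3 ≤ (U.filter fun k => c k = j).card with hB
  set V := U.filter fun k => c k ∈ B with hV
  have hVcard : V.card = ∑ j ∈ B, (U.filter fun k => c k = j).card := by
    rw [card_eq_sum_card_fiberwise (f := c) (t := B) (by intro k hk; exact (mem_filter.1 hk).2)]
    refine sum_congr rfl fun j hj => ?_
    congr 1
    ext k
    simp only [hV, mem_filter]
    constructor
    · rintro ⟨⟨h1, h2⟩, h3⟩; exact ⟨h1, h3⟩
    · rintro ⟨h1, h3⟩; exact ⟨⟨h1, h3 ▸ hj⟩, h3⟩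
  have hUcard : U.card = ∑ j ∈ Q, (U.filter fun k => c k = j).card :=
    card_eq_sum_card_fiberwise (f := c) (t := Q) hUQ
  have hsplit : ∑ j ∈ Q, (U.filter fun k => c k = j).card ≤
      ∑ j ∈ B, (U.filter fun k => c k = j).card + 2 * (Q.card - B.card) := by
    rw [← sum_filter_add_sum_filter_not Q (fun j => 3 ≤ (U.filter fun k => c k = j).card)]
    refine Nat.add_le_add_left ?_ _
    have h1 : (Q.filter fun j => ¬ 3 ≤ (U.filter fun k => c k = j).card).card = Q.card - B.card := by
      have h2 : B.card + (Q.filter fun j => ¬ 3 ≤ (U.filter fun k => c k = j).card).card = Q.card :=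
        card_filter_add_card_filter_not _
      omega
    rw [← h1, mul_comm]
    refine sum_le_card_nsmul _ _ 2 fun j hj => ?_
    have := (mem_filter.1 hj).2
    omega
  have hBQ : B.card ≤ Q.card := card_le_card (filter_subset _ _)
  have hUc : U.card = K.card + (2 * n - hi - hi) := by
    rw [hU, card_union_of_disjoint hdis, hT, Nat.card_Ico]
  refine ⟨B.card, V.card, ?_, ?_, ?_⟩
  · rw [hVcard, mul_comm]
    exact card_nsmul_le_sum _ _ 3 fun j hj => (mem_filter.1 hj).2
  -- The `d - hi - τ` bins outside `B` have at most two items each, and `T` accounts for `2 * (n -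
  -- hi)` items.
  · omega
  · have h1 : ∑ k ∈ V, (a k - ρ) ≤ B.card * (1 - 3 * ρ) := by
      rw [← sum_fiberwise_of_maps_to (g := c) (t := B) (fun k hk => (mem_filter.1 hk).2),
        ← nsmul_eq_mul]
      refine sum_le_card_nsmul _ _ _ fun j hj => ?_
      have hfe : (V.filter fun k => c k = j) = U.filter fun k => c k = j := by
        ext k
        simp only [hV, mem_filter]
        constructor
        · rintro ⟨⟨h1, h2⟩, h3⟩; exact ⟨h1, h3⟩
        · rintro ⟨h1, h3⟩; exact ⟨⟨h1, h3 ▸ hj⟩, h3⟩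
      rw [hfe, sum_sub_distrib, sum_const, nsmul_eq_mul]
      have h2 := h.sum_le_one (S := U.filter fun k => c k = j) (j := j)
        ((filter_subset _ _).trans hUL) (fun k hk => (mem_filter.1 hk).2)
      have h3 : (3 : ℝ) ≤ ((U.filter fun k => c k = j).card : ℝ) := by
        exact_mod_cast (mem_filter.1 hj).2
      nlinarith
    have h2 : ∑ k ∈ K, (a k - ρ) = ∑ k ∈ K with c k ∈ B, (a k - ρ) +
        ∑ k ∈ K with c k ∉ B, (a k - ρ) := (sum_filter_add_sum_filter_not _ _ _).symm
    have hVsplit : V = (K.filter fun k => c k ∈ B) ∪ T.filter fun k => c k ∈ B := by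
      rw [hV, hU, filter_union]
    have hdis' : Disjoint (K.filter fun k => c k ∈ B) (T.filter fun k => c k ∈ B) :=
      disjoint_filter_filter hdis
    have h3 : ∑ k ∈ V, (a k - ρ) = ∑ k ∈ K with c k ∈ B, (a k - ρ) +
        ∑ k ∈ T with c k ∈ B, (a k - ρ) := by
      rw [hVsplit, sum_union hdis']
    have h4 : V.card = (K.filter fun k => c k ∈ B).card + (T.filter fun k => c k ∈ B).card := by
      rw [hVsplit, card_union_of_disjoint hdis']
    have h5 : K.card = (K.filter fun k => c k ∈ B).card + (K.filter fun k => c k ∉ B).card :=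
      (card_filter_add_card_filter_not _).symm
    have h6 : ∑ k ∈ K with c k ∉ B, (a k - ρ) ≤ (K.filter fun k => c k ∉ B).card * y := by
      rw [← nsmul_eq_mul]
      exact sum_le_card_nsmul _ _ _ fun k hk => hy k (mem_filter.1 hk).1
    -- Items of `T` inside `B` are subtracted at value at least `y`, items of `K` outside `B` are
    -- added at most at `y`; the net coefficient of `y` is `K.card - q`.
    have h7 : (T.filter fun k => c k ∈ B).card * y ≤ ∑ k ∈ T with c k ∈ B, (a k - ρ) := by
      rw [← nsmul_eq_mul]
      exact card_nsmul_le_sum _ _ _ fun k hk => hyT k (mem_filter.1 hk).1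
    have h4' : (V.card : ℝ) = (K.filter fun k => c k ∈ B).card + (T.filter fun k => c k ∈ B).card := by
      exact_mod_cast h4
    have h5' : (K.card : ℝ) = (K.filter fun k => c k ∈ B).card + (K.filter fun k => c k ∉ B).card := by
      exact_mod_cast h5
    rw [h4', h5']
    nlinarith

end Packing

/-! ### The total excess of big bags and large later items -/

/-- A natural number below `n` that satisfies `p` lies in a maximal interval of such numbers. -/
theorem exists_maximal_interval (p : ℕ → Prop) {n i : ℕ} (hi : i < n) (hp : p i) :
    ∃ lo hi : ℕ, lo ≤ i ∧ i < hi ∧ hi ≤ n ∧ (∀ k ∈ Ico lo hi, p k) ∧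
      (lo = 0 ∨ ¬ p (lo - 1)) ∧ (hi = n ∨ ¬ p hi) := by
  classical
  have hex : ∃ h, i ≤ h ∧ (h = n ∨ ¬ p h) := ⟨n, hi.le, Or.inl rfl⟩
  set u := Nat.find hex with hu
  have hu1 := Nat.find_spec hex
  set q : ℕ → Prop := fun l => l = 0 ∨ ¬ p (l - 1)
  set l := Nat.findGreatest q i with hl
  have hl1 : q l := Nat.findGreatest_spec (Nat.zero_le i) (Or.inl rfl)
  have hl2 : l ≤ i := Nat.findGreatest_le i
  have hiu : i < u := by
    rcases hu1.1.lt_or_eq with h | h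
    · exact h
    · rcases hu1.2 with h' | h'
      · omega
      · exact absurd (h ▸ hp) h'
  refine ⟨l, u, hl2, hiu, Nat.find_min' hex ⟨hi.le, Or.inl rfl⟩, ?_, hl1, hu1.2⟩
  intro k hk
  rw [mem_Ico] at hk
  by_contra hpk
  rcases lt_or_ge k i with h | h
  · have := Nat.findGreatest_is_greatest (P := q) (show l < k + 1 by omega) (show k + 1 ≤ i by omega)
    exact this (Or.inr (by simpa using hpk))
  · exact Nat.find_min hex hk.2 ⟨h, Or.inr hpk⟩

namespace Packing

variable {d L n lo hi : ℕ} {a : ℕ → ℝ} {c : ℕ → Fin d}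

/-- The total size of the items of `K`, in bins other than those of the first `n` items. -/
theorem sum_le_of_bins (h : Packing d L a c) (hL : 2 * n ≤ L) (hnd : n ≤ d)
    (hsep : n ≠ 0 → 1 < a (n - 1) + a (2 * n - n))
    {K : Finset ℕ} (hK : K ⊆ range L) (hKc : ∀ k ∈ K, c k ∉ (range n).image c)
    {σ δ : ℝ} (hσ : 0 ≤ σ) (hσδ : σ ≤ δ) (hδ : 3 * δ ≤ 1) (hKδ : ∀ k ∈ K, a k ≤ 1 - δ) :
    ∑ k ∈ K, (a k - σ - δ) ≤ ((d - n : ℕ) : ℝ) * (1 - 3 * δ) + K.card * (δ - σ) := by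
  set Q := (univ : Finset (Fin d)) \ (range n).image c with hQ
  have hQcard : Q.card = d - n := by
    have h1 := card_sdiff_add_card_eq_card (subset_univ ((range n).image c))
    rw [h.card_head hL le_rfl hsep, card_univ, Fintype.card_fin] at h1
    have h2 : Q.card + n = d := h1
    omega
  have hKQ : ∀ k ∈ K, c k ∈ Q := fun k hk => by
    rw [hQ, mem_sdiff]; exact ⟨mem_univ _, hKc k hk⟩
  have hcard : (K.card : ℝ) = ∑ j ∈ Q, ((K.filter fun k => c k = j).card : ℝ) := by
    exact_mod_cast card_eq_sum_card_fiberwise (f := c) (t := Q) hKQ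
  rw [← sum_fiberwise_of_maps_to (g := c) (t := Q) hKQ, hcard, sum_mul, ← hQcard, ← nsmul_eq_mul,
    ← sum_const, ← sum_add_distrib]
  refine sum_le_sum fun j _ => ?_
  set S := K.filter fun k => c k = j with hS
  have h1 := h.sum_le_one (S := S) (j := j) ((filter_subset _ _).trans hK)
    (fun k hk => (mem_filter.1 hk).2)
  have h2 : ∑ k ∈ S, (a k - σ - δ) = ∑ k ∈ S, a k - S.card * (σ + δ) := by
    simp only [sub_sub]
    rw [sum_sub_distrib, sum_const, nsmul_eq_mul]
  -- A bin with `s` items of `K` is allowed `1 - 3δ + s(δ - σ)`. This suffices for `s = 0` by `3δ ≤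
  -- 1`, for `s = 1` by `a k ≤ 1 - δ`, and for `s ≥ 2` because `3 ≤ 2s`.
  rcases Nat.lt_or_ge S.card 2 with hlt | hge
  · rcases Nat.lt_or_ge S.card 1 with h0 | h0
    · have : S = ∅ := by rw [← card_eq_zero]; omega
      rw [this]; simp; linarith
    · obtain ⟨k, hk⟩ := card_eq_one.1 (show S.card = 1 by omega)
      have hkK : k ∈ K := by
        have : k ∈ S := by rw [hk]; simp
        exact (mem_filter.1 this).1
      have := hKδ k hkK
      rw [hk]; simp; linarith
  · have h3 : (2 : ℝ) ≤ S.card := by exact_mod_cast hge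
    rw [h2]
    nlinarith

/-- The bags `{t, 2 * n - 1 - t}` of size greater than `1 + σ`. -/
noncomputable def bigBags (a : ℕ → ℝ) (n : ℕ) (σ : ℝ) : Finset ℕ :=
  open Classical in (range n).filter fun t => 1 + σ < a t + a (2 * n - 1 - t)

theorem mem_bigBags {σ : ℝ} {t : ℕ} :
    t ∈ bigBags a n σ ↔ t < n ∧ 1 + σ < a t + a (2 * n - 1 - t) := by
  simp [bigBags]

/-- The excess of the big bags is bounded by the sizes of the items `K` in bins other than those of
the first `hi` items, after a block of big bags is paid for by the free space in these bins. -/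
theorem exists_sum_excess_le (h : Packing d L a c) (hL : 2 * n ≤ L) (hhi : hi ≤ n) (hlo : lo ≤ hi)
    {σ δ η : ℝ} (hσ : 0 ≤ σ) (hblock : ∀ i ∈ Ico lo hi, i ∈ bigBags a n σ)
    (hne : lo < hi ∨ hi = 0)
    {X : Finset ℕ} (hX : X ⊆ Ico (2 * n) L) (hδ : 0 ≤ δ) (hδlo : lo = 0 → δ = 0)
    (hδi : ∀ i ∈ Ico lo hi, δ ≤ 1 - a i)
    (hη : ∀ t ∈ bigBags a n σ, t ∉ Ico lo hi → a t + a (2 * n - 1 - t) - 1 - σ ≤ η)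
    (hηX : lo ≠ 0 → ∀ k ∈ X, a k - σ ≤ η) :
    ∃ (K : Finset ℕ) (E : ℕ), K ⊆ range L ∧ (∀ k ∈ K, c k ∉ (range hi).image c) ∧
      (∀ k ∈ K, 2 * n - hi ≤ k ∧ (lo ≠ 0 → k < 2 * n - lo)) ∧
      K.card + E ≤ (bigBags a n σ).card + X.card ∧
      ∑ t ∈ bigBags a n σ, (a t + a (2 * n - 1 - t) - 1 - σ) + ∑ k ∈ X, (a k - σ) ≤
        ∑ k ∈ K, (a k - σ - δ) + E * η := by
  classical
  -- For `lo = 0` the items of `X` are treated by bins like the partners, with `δ = 0`; otherwise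
  -- each of them is just bounded by `η`.
  obtain ⟨Y, Z, hYX, hYlo, hZlo, hYZ, hYZc⟩ : ∃ Y Z : Finset ℕ, Y ⊆ X ∧ (lo ≠ 0 → Y = ∅) ∧
      (∀ k ∈ Z, a k - σ ≤ η) ∧ ∑ k ∈ Y, (a k - σ) + ∑ k ∈ Z, (a k - σ) = ∑ k ∈ X, (a k - σ) ∧
      Y.card + Z.card = X.card := by
    by_cases h0 : lo = 0
    · exact ⟨X, ∅, subset_rfl, fun h => absurd h0 h, by simp, by simp, by simp⟩
    · exact ⟨∅, X, by simp, by simp, hηX h0, by simp, by simp⟩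
  have hsep : hi ≠ 0 → 1 < a (hi - 1) + a (2 * n - hi) := by
    intro h0
    have := (mem_bigBags.1 (hblock (hi - 1) (by rw [mem_Ico]; omega))).2
    rw [show 2 * n - 1 - (hi - 1) = 2 * n - hi by omega] at this
    linarith
  have hb : ∀ i ∈ Ico lo hi, 1 < a i + a (2 * n - 1 - i) := fun i hi' => by
    have := (mem_bigBags.1 (hblock i hi')).2; linarith
  have hYc : Y = ∅ ∨ δ = 0 := by
    by_cases h0 : lo = 0
    exacts [Or.inr (hδlo h0), Or.inl (hYlo h0)]
  have key := h.sum_sub_le hL hhi hlo hsep hb (hYX.trans hX) hYlo hσ hδ hYc hδi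
  set R := bigBags a n σ \ Ico lo hi with hR
  have hsub : Ico lo hi ⊆ bigBags a n σ := hblock
  have hdis : Disjoint (Ico (2 * n - hi) (2 * n - lo)) Y := by
    rw [disjoint_left]
    intro k hk hk'
    have := hX (hYX hk'); rw [mem_Ico] at this hk; omega
  refine ⟨(Ico (2 * n - hi) (2 * n - lo) ∪ Y).filter fun k => c k ∉ (range hi).image c,
    R.card + Z.card, ?_, fun k hk => (mem_filter.1 hk).2, ?_, ?_, ?_⟩
  rotate_left 3
  · have h1 : ∑ k ∈ Ico (2 * n - hi) (2 * n - lo) ∪ Y, (a k - σ) =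
        ∑ i ∈ Ico lo hi, (a (2 * n - 1 - i) - σ) + ∑ k ∈ Y, (a k - σ) := by
      rw [sum_union hdis]
      congr 1
      refine sum_nbij' (fun k => 2 * n - 1 - k) (fun k => 2 * n - 1 - k) ?_ ?_ ?_ ?_ ?_
      · intro k hk; rw [mem_Ico] at hk ⊢; omega
      · intro k hk; rw [mem_Ico] at hk ⊢; omega
      · intro k hk; rw [mem_Ico] at hk; omega
      · intro k hk; rw [mem_Ico] at hk; omega
      · intro k hk; rw [mem_Ico] at hk; congr 2; omega
    have h2 : ∑ t ∈ bigBags a n σ, (a t + a (2 * n - 1 - t) - 1 - σ) =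
        ∑ t ∈ R, (a t + a (2 * n - 1 - t) - 1 - σ) +
        ∑ t ∈ Ico lo hi, (a t + a (2 * n - 1 - t) - 1 - σ) := (sum_sdiff hsub).symm
    have h3 : ∑ t ∈ Ico lo hi, (a t + a (2 * n - 1 - t) - 1 - σ) =
        ∑ i ∈ Ico lo hi, (a (2 * n - 1 - i) - σ) - ∑ i ∈ Ico lo hi, (1 - a i) := by
      rw [← sum_sub_distrib]
      exact sum_congr rfl fun i _ => by ring
    have h4 : ∑ t ∈ R, (a t + a (2 * n - 1 - t) - 1 - σ) ≤ R.card * η := by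
      rw [← nsmul_eq_mul]
      exact sum_le_card_nsmul _ _ _ fun t ht => hη t (mem_sdiff.1 ht).1 (mem_sdiff.1 ht).2
    have h5 : ∑ k ∈ Z, (a k - σ) ≤ Z.card * η := by
      rw [← nsmul_eq_mul]
      exact sum_le_card_nsmul _ _ _ hZlo
    push_cast
    linarith
  · intro k hk
    rcases mem_union.1 (mem_filter.1 hk).1 with hk | hk
    · rw [mem_Ico] at hk; simp; omega
    · have := hX (hYX hk); rw [mem_Ico] at this; simp; omega
  · intro k hk
    rcases mem_union.1 (mem_filter.1 hk).1 with hk' | hk'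
    · rw [mem_Ico] at hk'; omega
    · have := hX (hYX hk'); rw [mem_Ico] at this
      refine ⟨by omega, fun h0 => ?_⟩
      rw [hYlo h0] at hk'; simp at hk'
  · have h1 := card_filter_le (Ico (2 * n - hi) (2 * n - lo) ∪ Y)
      (fun k => c k ∉ (range hi).image c)
    rw [card_union_of_disjoint hdis, Nat.card_Ico] at h1
    have h2 : R.card + (hi - lo) = (bigBags a n σ).card := by
      have := card_sdiff_add_card_eq_card hsub
      rwa [Nat.card_Ico] at this
    omega

/-- The case of `sum_excess_le` where a bag of size at most `1 + σ` follows the block of large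
bags. -/
theorem sum_excess_le_of_interior (h : Packing d L a c) (hL : 2 * n ≤ L) (hnd : n ≤ d) (hhi : hi < n)
    (hlo : lo ≤ hi) {σ ρ z y : ℝ} (hσ : 0 ≤ σ) (hblock : ∀ i ∈ Ico lo hi, i ∈ bigBags a n σ)
    (hne : lo < hi ∨ hi = 0)
    {X : Finset ℕ} (hX : X ⊆ Ico (2 * n) L) (hρ : 0 ≤ ρ) (hz : 0 ≤ z)
    (hδlo : lo = 0 → z + ρ = 0)
    (hδi : ∀ i ∈ Ico lo hi, z + ρ ≤ 1 - a i) (hyhi : y = a (2 * n - 1 - hi) - σ - ρ)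
    (hy : 2 * y ≤ 1 - 3 * σ) (hyz : 1 - 3 * σ ≤ 3 * (y - z))
    (hη : ∀ t ∈ bigBags a n σ, t ∉ Ico lo hi →
      a t + a (2 * n - 1 - t) - 1 - σ ≤ z + (1 - 3 * σ) - 2 * y)
    (hηX : lo ≠ 0 → ∀ k ∈ X, a k - σ ≤ z + (1 - 3 * σ) - 2 * y)
    (hcard : (bigBags a n σ).card + X.card ≤ 3 * (d - n)) :
    ∑ t ∈ bigBags a n σ, (a t + a (2 * n - 1 - t) - 1 - σ) + ∑ k ∈ X, (a k - σ) ≤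
      ((d - n : ℕ) : ℝ) * (1 - 3 * σ) := by
  obtain ⟨K, E, hKL, hKc, hKhi, hKE, hle⟩ := h.exists_sum_excess_le hL hhi.le hlo hσ hblock hne hX
    (add_nonneg hz hρ) hδlo hδi hη hηX
  refine hle.trans ?_
  have hsep : hi ≠ 0 → 1 < a (hi - 1) + a (2 * n - hi) := by
    intro h0
    have := (mem_bigBags.1 (hblock (hi - 1) (by rw [mem_Ico]; omega))).2
    rw [show 2 * n - 1 - (hi - 1) = 2 * n - hi by omega] at this
    linarith
  have hKy : ∀ k ∈ K, a k - (σ + ρ) ≤ y := by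
    intro k hk
    have := h.antitone (show 2 * n - 1 - hi ≤ k by have := (hKhi k hk).1; omega)
    linarith
  obtain ⟨τ, q, hq1, hq2, hq3⟩ := h.exists_sum_le hL hhi.le hnd hsep hKL hKc
    (fun k hk => (hKhi k hk).1) (add_nonneg hσ hρ) hKy (by
      intro k hk
      rw [mem_Ico] at hk
      have := h.antitone (show k ≤ 2 * n - 1 - hi by omega)
      linarith)
  have hsum : ∑ k ∈ K, (a k - σ - (z + ρ)) = ∑ k ∈ K, (a k - (σ + ρ)) - K.card * z := by
    rw [← nsmul_eq_mul, ← sum_const, ← sum_sub_distrib]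
    exact sum_congr rfl fun _ _ => by ring
  rw [hsum]
  set D : ℝ := ((d - n : ℕ) : ℝ) with hD
  have hKE' : (K.card : ℝ) + E ≤ 3 * D := by rw [hD]; exact_mod_cast hKE.trans hcard
  have hq1' : 3 * (τ : ℝ) ≤ q := by exact_mod_cast hq1
  have hq2' : (K.card : ℝ) + 2 * τ ≤ q + 2 * D := by rw [hD]; exact_mod_cast hq2
  have hE0 : (0 : ℝ) ≤ E := Nat.cast_nonneg _
  have hK0 : (0 : ℝ) ≤ K.card := Nat.cast_nonneg _
  have hτ0 : (0 : ℝ) ≤ τ := Nat.cast_nonneg _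
  have hy0 : 0 ≤ y := by linarith
  have hKsum : ∑ k ∈ K, (a k - (σ + ρ)) ≤ K.card * y := by
    rw [← nsmul_eq_mul]
    exact sum_le_card_nsmul _ _ _ hKy
  generalize (K.card : ℝ) = k at *
  generalize (E : ℝ) = e at *
  generalize (τ : ℝ) = t at *
  generalize (q : ℝ) = r at *
  set Δ := 1 - 3 * σ with hΔ
  have hqt : ∑ k ∈ K, (a k - (σ + ρ)) ≤ t * Δ + (k - r) * y := by nlinarith
  -- It remains to bound `(sum over K) - k z + e (z + Δ - 2y)` by `D Δ`. For `e ≤ k` the terms in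
  -- `z` can be dropped, and `k - r` is at most both `2(D - t)` and `3(D - t) - e`, which agree at
  -- `e = D - t`. For `e > k` the bound `k y` on the sum suffices, with `e ≤ 3D - k` and `k ≤ 2D`.
  rcases le_or_gt e k with hek | hek
  · have h1 : e * z ≤ k * z := mul_le_mul_of_nonneg_right hek hz
    suffices t * Δ + (k - r) * y + e * (Δ - 2 * y) ≤ D * Δ by linarith
    rcases le_or_gt e (D - t) with h2 | h2
    · have h3 : (k - r) * y ≤ 2 * (D - t) * y := mul_le_mul_of_nonneg_right (by linarith) hy0
      have h4 : e * (Δ - 2 * y) ≤ (D - t) * (Δ - 2 * y) :=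
        mul_le_mul_of_nonneg_right h2 (by linarith)
      linarith
    · have h3 : (k - r) * y ≤ (3 * (D - t) - e) * y := mul_le_mul_of_nonneg_right (by linarith) hy0
      have h4 : e * (3 * y - Δ) ≥ (D - t) * (3 * y - Δ) :=
        mul_le_mul_of_nonneg_right h2.le (by linarith)
      linarith
  · have h2 : e * (z + Δ - 2 * y) ≤ (3 * D - k) * (z + Δ - 2 * y) :=
      mul_le_mul_of_nonneg_right (by linarith) (by linarith)
    have h3 : k * (3 * (y - z) - Δ) ≤ 2 * D * (3 * (y - z) - Δ) :=
      mul_le_mul_of_nonneg_right (by linarith) (by linarith)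
    have h4 : 0 ≤ D := by linarith
    nlinarith [mul_nonneg h4 hz, mul_nonneg hK0 hz]

variable {f : ℕ}

/-- The case of `sum_excess_le` where the block of large bags extends to the last bag. -/
theorem sum_excess_le_of_final (h : Packing d L a c) (hL : 2 * n ≤ L) (hnd : n ≤ d)
    {i : ℕ} (hloi : lo ≤ i) (hin : i < n) {σ δ : ℝ} (hσ : 0 ≤ σ)
    (hblock : ∀ i ∈ Ico lo n, i ∈ bigBags a n σ) (hlo : lo ≠ 0)
    {X : Finset ℕ} (hX : X ⊆ Ico (2 * n) L) (hσδ : σ ≤ δ)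
    (hδi : ∀ i ∈ Ico lo n, δ ≤ 1 - a i) (hheavy : 1 - 3 * σ < 3 * (a i + a (2 * n - 1 - i) - 1 - σ))
    (hη : ∀ t ∈ bigBags a n σ, t < lo → a t + a (2 * n - 1 - t) - 1 - σ ≤ δ - σ)
    (hηX : ∀ k ∈ X, a k - σ ≤ δ - σ)
    (hcard : (bigBags a n σ).card + X.card ≤ 3 * (d - n)) :
    ∑ t ∈ bigBags a n σ, (a t + a (2 * n - 1 - t) - 1 - σ) + ∑ k ∈ X, (a k - σ) ≤
      ((d - n : ℕ) : ℝ) * (1 - 3 * σ) := by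
  obtain ⟨K, E, hKL, hKc, hKhi, hKE, hle⟩ := h.exists_sum_excess_le hL le_rfl (by omega : lo ≤ n) hσ
    hblock (Or.inl (by omega)) hX (hσ.trans hσδ) (fun h0 => absurd h0 hlo) hδi
    (fun t ht ht' => hη t ht (by
      have := (mem_bigBags.1 ht).1; rw [mem_Ico] at ht'; omega)) (fun _ => hηX)
  have hsep : n ≠ 0 → 1 < a (n - 1) + a (2 * n - n) := by
    intro h0
    have := (mem_bigBags.1 (hblock (n - 1) (by rw [mem_Ico]; omega))).2
    rw [show 2 * n - 1 - (n - 1) = 2 * n - n by omega] at this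
    linarith
  -- A heavy bag has size above `4/3`, so its first item is larger than `2/3` and `δ < 1/3`.
  have h1 := hδi i (by rw [mem_Ico]; omega)
  have h2 := h.antitone (show i ≤ 2 * n - 1 - i by omega)
  have h3 := h.sum_le_of_bins hL hnd hsep hKL hKc hσ hσδ (by linarith) (by
    intro k hk
    have := h.antitone (show i ≤ k by have := (hKhi k hk).1; omega)
    linarith)
  have h4 : (K.card : ℝ) + E ≤ 3 * ((d - n : ℕ) : ℝ) := by exact_mod_cast hKE.trans hcard
  have h5 := mul_le_mul_of_nonneg_right h4 (sub_nonneg.2 hσδ)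
  linarith

/-- A bound on the total excess of the bags `{t, 2 * n - 1 - t}` above `1 + σ` and of the further
items above `σ`, if one of the bags has size `1 - σ`. -/
theorem sum_excess_le (h : Packing d L a c) (hL : 2 * n ≤ L) (hnd : n ≤ d) {σ : ℝ} (hσ : 0 ≤ σ)
    (hσ3 : 3 * σ < 1) (hf : f < n) (haf : a f + a (2 * n - 1 - f) = 1 - σ)
    {X : Finset ℕ} (hX : X ⊆ Ico (2 * n) L)
    (hcard : (bigBags a n σ).card + X.card ≤ 3 * (d - n)) :
    ∑ t ∈ bigBags a n σ, (a t + a (2 * n - 1 - t) - 1 - σ) + ∑ k ∈ X, (a k - σ) ≤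
      ((d - n : ℕ) : ℝ) * (1 - 3 * σ) := by
  have hfA : f ∉ bigBags a n σ := fun hm => by have := (mem_bigBags.1 hm).2; linarith
  have hnot : ∀ t < n, t ∉ bigBags a n σ → a (2 * n - 1 - t) - σ ≤ 1 - a t := by
    intro t ht htA
    by_contra! hlt
    exact htA (mem_bigBags.2 ⟨ht, by linarith⟩)
  have hb : ∀ s t : ℕ, s ≤ t → a (2 * n - 1 - s) ≤ a (2 * n - 1 - t) := fun s t hst =>
    h.antitone (by omega)
  have hba : ∀ t < n, a (2 * n - 1 - t) ≤ a t := fun t ht => h.antitone (by omega)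
  have h1 : ∀ t < n, a t ≤ 1 := fun t ht => h.le_one (by omega)
  have hXa : ∀ k ∈ X, ∀ t, a k ≤ a (2 * n - 1 - t) := fun k hk t =>
    h.antitone (by have := hX hk; rw [mem_Ico] at this; omega)
  have hbf0 := h.nonneg (2 * n - 1 - f)
  have hbaf := hba f hf
  -- the block before `f`
  have main : ∀ lo hi : ℕ, lo ≤ hi → hi ≤ f → hi ∉ bigBags a n σ → (lo < hi ∨ hi = 0) →
      (∀ k ∈ Ico lo hi, k ∈ bigBags a n σ) → (lo = 0 ∨ lo - 1 ∉ bigBags a n σ) →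
      ((∃ i, lo ≤ i ∧ i < hi ∧ 1 - 3 * σ ≤ 3 * (a i + a (2 * n - 1 - i) - 1 - σ)) ∨
        (lo = 0 ∧ ∃ k ∈ X, 1 - 3 * σ ≤ 3 * (a k - σ))) →
      ∑ t ∈ bigBags a n σ, (a t + a (2 * n - 1 - t) - 1 - σ) + ∑ k ∈ X, (a k - σ) ≤
      ((d - n : ℕ) : ℝ) * (1 - 3 * σ) := by
    intro lo hi hlohi hhif hhiA hne hblock hloA hheavy
    -- Bag `lo - 1` is not big, so its second item exceeds `σ` by at most the free space beside any
    -- block item. Since first items are at most 1, that amount also bounds the excess of all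
    -- earlier bags.
    obtain ⟨z, hz, hz0, hzi, hzlt, hzX⟩ : ∃ z : ℝ, 0 ≤ z ∧ (lo = 0 → z = 0) ∧
        (∀ i, lo ≤ i → i < n → z ≤ 1 - a i) ∧
        (∀ t < lo, a t + a (2 * n - 1 - t) - 1 - σ ≤ z) ∧ (lo ≠ 0 → ∀ k ∈ X, a k - σ ≤ z) := by
      by_cases h0 : lo = 0
      · exact ⟨0, le_rfl, fun _ => rfl, fun i _ hi => by linarith [h1 i hi], fun t ht => by omega,
          fun h => absurd h0 h⟩
      · have hloA' := hloA.resolve_left h0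
        refine ⟨max (a (2 * n - 1 - (lo - 1)) - σ) 0, le_max_right _ _, fun h => absurd h h0,
          fun i hi hin => max_le ?_ (by linarith [h1 i hin]), fun t ht => le_max_of_le_left ?_,
          fun _ k hk => le_max_of_le_left (by linarith [hXa k hk (lo - 1)])⟩
        · have := hnot (lo - 1) (by omega) hloA'
          have := h.antitone (show lo - 1 ≤ i by omega)
          linarith
        · have := hb t (lo - 1) (by omega)
          have := h1 t (by omega)
          linarith
    set y := a (2 * n - 1 - hi) - σ with hy
    have hhif' := hb hi f hhif
    have hhiA' := hnot hi (by omega) hhiA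
    -- As `z ≤ 1 - a i` and partners grow with the index, `y - z` is at least the excess of the
    -- heavy bag `i`; for a heavy item `k`, `z = 0` and `y ≥ a k - σ`.
    have hyz : 1 - 3 * σ ≤ 3 * (y - z) := by
      rcases hheavy with ⟨i, hi1, hi2, hi3⟩ | ⟨h0, k, hk, hk3⟩
      · have := hb i hi hi2.le
        have := hzi i hi1 (by omega)
        linarith
      · have := hXa k hk hi
        have := hz0 h0
        linarith
    refine h.sum_excess_le_of_interior hL hnd (hhif.trans_lt hf) hlohi (z := z) (ρ := 0) (y := y) hσ
      hblock hne hX le_rfl hz (fun h0 => by simp [hz0 h0]) (fun i hi' => ?_) (by simp [hy])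
      (by linarith) hyz ?_ (fun h0 k hk => by linarith [hzX h0 k hk]) hcard
    · rw [mem_Ico] at hi'
      have := hzi i hi'.1 (by omega)
      linarith
    · intro t ht htB
      have htn := (mem_bigBags.1 ht).1
      rw [mem_Ico] at htB
      rcases lt_or_ge t lo with htlo | htlo
      · linarith [hzlt t htlo]
      · have hthi : hi ≤ t := by omega
        rcases le_or_gt t f with htf | htf
        · have := h.antitone hthi
          have := hb t f htf
          linarith
        · have := h.antitone htf.le
          have := hba t htn
          linarith
  -- The threshold is the mean excess permitted by `hcard`: it means size above `4/3` for a bag and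
  -- above `1/3` for an item of `X`.
  by_cases hA : ∃ i ∈ bigBags a n σ, 1 - 3 * σ < 3 * (a i + a (2 * n - 1 - i) - 1 - σ)
  · obtain ⟨i, hiA, hheavy⟩ := hA
    obtain ⟨lo, hi, hloi, hihi, hhin, hblock, hloA, hhiA⟩ :=
      exists_maximal_interval (· ∈ bigBags a n σ) (mem_bigBags.1 hiA).1 hiA
    rcases le_or_gt hi f with hhif | hhif
    · exact main lo hi (by omega) hhif (hhiA.resolve_left (by omega)) (Or.inl (by omega)) hblock hloA
        (Or.inl ⟨i, hloi, hihi, hheavy.le⟩)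
    · have hflo : f < lo := by
        by_contra! hle
        exact hfA (hblock f (mem_Ico.2 ⟨hle, hhif⟩))
      have hlo0 : lo ≠ 0 := by omega
      have hloA' := hnot (lo - 1) (by omega) (hloA.resolve_left hlo0)
      -- The block lies after `f`, so `1 - a f` is at most the free space beside each block item. It
      -- is at least `σ`, as bag `f` has size `1 - σ`.
      set δ := max (1 - a f) (a (2 * n - 1 - (lo - 1)) - σ) with hδ
      have hδf : 1 - a f ≤ δ := le_max_left _ _
      have hδlo : a (2 * n - 1 - (lo - 1)) - σ ≤ δ := le_max_right _ _
      have hδi : ∀ i ∈ Ico lo hi, δ ≤ 1 - a i := by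
        intro i hi'
        rw [mem_Ico] at hi'
        have := h.antitone (show f ≤ i by omega)
        have := h.antitone (show lo - 1 ≤ i by omega)
        exact max_le (by linarith) (by linarith)
      have hηX : ∀ k ∈ X, a k - σ ≤ δ - σ := fun k hk => by linarith [hXa k hk f]
      have hη : ∀ t ∈ bigBags a n σ, t < lo → a t + a (2 * n - 1 - t) - 1 - σ ≤ δ - σ := by
        intro t ht htlo
        have htn := (mem_bigBags.1 ht).1
        have := h1 t htn
        rcases le_or_gt t f with htf | htf
        · have := hb t f htf
          linarith
        · have := h.antitone htf.le
          have := hb t (lo - 1) (by omega)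
          linarith
      by_cases hhin' : hi = n
      · subst hhin'
        exact h.sum_excess_le_of_final hL hnd hloi hihi hσ hblock hlo0 hX (by linarith) hδi hheavy hη hηX
          hcard
      · have hhiA' := hnot hi (by omega) (hhiA.resolve_left hhin')
        have hbahi := hba hi (by omega)
        have hδi' := hδi i (mem_Ico.2 ⟨hloi, hihi⟩)
        have hbi := hb i hi hihi.le
        -- After `f`, bag `hi` only gives `2 * a (2 * n - 1 - hi) ≤ 1 + σ`, instead of `1 - σ` as
        -- before `f`. Taking `ρ = σ` restores `2 * y ≤ 1 - 3 * σ`.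
        refine h.sum_excess_le_of_interior hL hnd (by omega) (by omega) (z := δ - σ) (ρ := σ)
          (y := a (2 * n - 1 - hi) - σ - σ) hσ hblock (Or.inl (by omega)) hX hσ (by linarith)
          (fun h0 => absurd h0 hlo0) (by simpa using hδi) rfl (by linarith) (by linarith) ?_
          (fun _ k hk => by linarith [hηX k hk]) hcard
        intro t ht htB
        have htn := (mem_bigBags.1 ht).1
        rw [mem_Ico] at htB
        rcases lt_or_ge t lo with htlo | htlo
        · linarith [hη t ht htlo]
        · have := h.antitone (show hi ≤ t by omega)
          have := hba t htn
          linarith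
  · push Not at hA
    by_cases hX' : ∃ k ∈ X, 1 - 3 * σ < 3 * (a k - σ)
    · obtain ⟨k, hk, hheavy⟩ := hX'
      classical
      have hex : ∃ t, t ∉ bigBags a n σ := ⟨f, hfA⟩
      -- The block of big bags before the first bag that is not big; it may be empty.
      refine main 0 (Nat.find hex) (Nat.zero_le _) (Nat.find_min' hex hfA) (Nat.find_spec hex)
        (Nat.eq_zero_or_pos _).symm (fun t ht => ?_) (Or.inl rfl) (Or.inr ⟨rfl, k, hk, hheavy.le⟩)
      by_contra htA
      exact Nat.find_min hex (mem_Ico.1 ht).2 htA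
    · push Not at hX'
      have h2 : ∑ t ∈ bigBags a n σ, (a t + a (2 * n - 1 - t) - 1 - σ) ≤
          (bigBags a n σ).card * ((1 - 3 * σ) / 3) := by
        rw [← nsmul_eq_mul]
        exact sum_le_card_nsmul _ _ _ fun t ht => by linarith [hA t ht]
      have h3 : ∑ k ∈ X, (a k - σ) ≤ X.card * ((1 - 3 * σ) / 3) := by
        rw [← nsmul_eq_mul]
        exact sum_le_card_nsmul _ _ _ fun t ht => by linarith [hX' t ht]
      have h4 : ((bigBags a n σ).card : ℝ) + X.card ≤ 3 * ((d - n : ℕ) : ℝ) := by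
        exact_mod_cast hcard
      have h5 := mul_le_mul_of_nonneg_right h4 (show 0 ≤ (1 - 3 * σ) / 3 by linarith)
      linarith

/-! ### A stuck filling contradicts the total size -/

variable {f₀ : ℕ} {h : ℕ → ℕ}

theorem sum_range_two_mul (a : ℕ → ℝ) (n : ℕ) :
    ∑ k ∈ range (2 * n), a k = ∑ t ∈ range n, (a t + a (2 * n - 1 - t)) := by
  rw [sum_add_distrib, range_eq_Ico, ← sum_Ico_consecutive a (Nat.zero_le n) (by omega : n ≤ 2 * n),
    ← range_eq_Ico]
  congr 1
  refine sum_nbij' (fun k => 2 * n - 1 - k) (fun k => 2 * n - 1 - k) ?_ ?_ ?_ ?_ ?_ <;>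
    intro k hk <;> simp only [mem_Ico, mem_range] at hk ⊢ <;> try omega
  congr 1; omega

/-- The small items are distributed among the bags `{t, 2 * n - 1 - t}` so that a bag with small
items has size less than one after the removal of one of them, and the bag `f₀` has size less than
one. This is impossible if there are many full bins. -/
theorem not_stuck (hp : Packing d L a c) (htot : ∑ k ∈ range L, a k = d) (hL : 2 * n ≤ L)
    (hnd : 4 * n ≤ 3 * d) (hh : ∀ k ∈ Ico (2 * n) L, h k < n) (hf₀ : f₀ < n)
    (hbag : ∀ t < n, t ≠ f₀ → (∀ k ∈ Ico (2 * n) L, h k ≠ t) ∨ ∃ g ∈ Ico (2 * n) L, h g = t ∧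
      a t + a (2 * n - 1 - t) + ∑ k ∈ Ico (2 * n) L with h k = t, a k - a g < 1)
    (hbag₀ : a f₀ + a (2 * n - 1 - f₀) + ∑ k ∈ Ico (2 * n) L with h k = f₀, a k < 1) : False := by
  classical
  set F : ℕ → Finset ℕ := fun t => (Ico (2 * n) L).filter fun k => h k = t with hF
  have hbag' : ∀ t < n, t ≠ f₀ → F t = ∅ ∨ ∃ g ∈ F t,
      a t + a (2 * n - 1 - t) + ∑ k ∈ F t, a k - a g < 1 := by
    intro t ht htf
    rcases hbag t ht htf with hb | ⟨g, hg, hgt, hlt⟩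
    · exact Or.inl (filter_eq_empty_iff.2 hb)
    · exact Or.inr ⟨g, mem_filter.2 ⟨hg, hgt⟩, hlt⟩
  have hbag₀' : a f₀ + a (2 * n - 1 - f₀) + ∑ k ∈ F f₀, a k < 1 := hbag₀
  have hFmem : ∀ t, ∀ k ∈ F t, 2 * n ≤ k := fun t k hk => (mem_Ico.1 (mem_filter.1 hk).1).1
  have hFnn : ∀ t, 0 ≤ ∑ k ∈ F t, a k := fun t => sum_nonneg fun k _ => hp.nonneg k
  have hgsum : ∀ t, ∀ g ∈ F t, ∑ k ∈ F t, a k = a g + ∑ k ∈ (F t).erase g, a k := fun t g hg =>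
    (add_sum_erase _ _ hg).symm
  have hFer : ∀ t g, 0 ≤ ∑ k ∈ (F t).erase g, a k := fun t g => sum_nonneg fun k _ => hp.nonneg k
  have hfib : ∀ b : ℕ → ℝ, ∑ k ∈ Ico (2 * n) L, b k = ∑ t ∈ range n, ∑ k ∈ F t, b k := fun b =>
    (sum_fiberwise_of_maps_to (fun k hk => mem_range.2 (hh k hk)) b).symm
  have htot' : (d : ℝ) = ∑ t ∈ range n, (a t + a (2 * n - 1 - t) + ∑ k ∈ F t, a k) := by
    rw [sum_add_distrib, ← hfib, ← sum_range_two_mul, range_eq_Ico, sum_Ico_consecutive a _ hL,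
      ← htot, range_eq_Ico]
    omega
  have hndR : 4 * (n : ℝ) ≤ 3 * d := by exact_mod_cast hnd
  obtain ⟨f, hf, hmin⟩ := exists_min_image (range n) (fun t => a t + a (2 * n - 1 - t))
    ⟨f₀, mem_range.2 hf₀⟩
  have hf := mem_range.1 hf
  obtain ⟨σ, hσ⟩ : ∃ σ, σ = 1 - (a f + a (2 * n - 1 - f)) := ⟨_, rfl⟩
  have hmin' : ∀ t < n, 1 - σ ≤ a t + a (2 * n - 1 - t) := fun t ht => by
    have := hmin t (mem_range.2 ht); linarith
  have hσ0 : 0 < σ := by linarith [hmin' f₀ hf₀, hFnn f₀]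
  have hbaf := hp.antitone (show f ≤ 2 * n - 1 - f by omega)
  rcases le_or_gt 1 (3 * σ) with hσ3 | hσ3
  -- Here bag `f` has size at most `2/3`, so its second item and all later ones are at most `1/3`,
  -- and the items from `f` on are at most `2/3`.
  · have hle : ∀ t ∈ range n, a t + a (2 * n - 1 - t) + ∑ k ∈ F t, a k ≤ 4 / 3 := by
      intro t ht
      have ht := mem_range.1 ht
      by_cases htf : t = f₀
      · subst htf; linarith
      rcases hbag' t ht htf with he | ⟨g, hg, hlt⟩
      · rw [he, sum_empty]
        rcases le_or_gt t f with htf' | htf'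
        · have := hp.antitone (show 2 * n - 1 - f ≤ 2 * n - 1 - t by omega)
          have := hp.le_one (show t < L by omega)
          linarith
        · have := hp.antitone htf'.le
          have := hp.antitone (show t ≤ 2 * n - 1 - t by omega)
          have := hp.nonneg (2 * n - 1 - f)
          linarith
      · have := hp.antitone (show 2 * n - 1 - f ≤ g by have := hFmem t g hg; omega)
        linarith
    have hlt : ∑ t ∈ range n, (a t + a (2 * n - 1 - t) + ∑ k ∈ F t, a k) < ∑ t ∈ range n, 4 / 3 :=
      sum_lt_sum hle ⟨f₀, mem_range.2 hf₀, by linarith⟩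
    rw [← htot', sum_const, card_range, nsmul_eq_mul] at hlt
    linarith
  · set X := (Ico (2 * n) L).filter fun k => σ ≤ a k with hX
    have hFX : ∀ t, (X.filter fun k => h k = t) = (F t).filter fun k => σ ≤ a k := fun t => by
      rw [hX, hF, filter_filter, filter_filter]; simp only [and_comm]
    have hAF : ∀ t ∈ bigBags a n σ, F t = ∅ ∧ t ≠ f₀ := by
      intro t ht
      obtain ⟨htn, hlt⟩ := mem_bigBags.1 ht
      have htf : t ≠ f₀ := by
        rintro rfl
        linarith [hFnn t]
      refine ⟨(hbag' t htn htf).resolve_right ?_, htf⟩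
      rintro ⟨g, hg, hg'⟩
      linarith [hgsum t g hg, hFer t g]
    have hXcard : ∀ t < n, (X.filter fun k => h k = t).card ≤ if t ∈ bigBags a n σ then 0 else 1 := by
      intro t ht
      rw [hFX]
      split_ifs with htA
      · rw [(hAF t htA).1]; simp
      · rw [card_le_one]
        -- After the removal of `g`, the initial bag of size at least `1 - σ` and the item `k` of
        -- size at least `σ` remain.
        have key : ∀ g k, g ∈ F t → k ∈ F t → k ≠ g → σ ≤ a k →
            1 ≤ a t + a (2 * n - 1 - t) + ∑ k ∈ F t, a k - a g := by
          intro g k hg hk hkg hσk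
          have h1 := single_le_sum (fun k _ => hp.nonneg k) (mem_erase.2 ⟨hkg, hk⟩)
          linarith [hgsum t g hg, hmin' t ht]
        intro k hk l hl
        rw [mem_filter] at hk hl
        by_contra hkl
        by_cases htf : t = f₀
        · subst htf
          linarith [key l k hl.1 hk.1 hkl hk.2, hp.nonneg l]
        · rcases hbag' t ht htf with he | ⟨g, hg, hlt⟩
          · rw [he] at hk; simp at hk
          · by_cases hkg : k = g
            · subst hkg; linarith [key k l hg hl.1 (Ne.symm hkl) hl.2]
            · linarith [key g k hg hk.1 hkg hk.2]
    have hcard : (bigBags a n σ).card + X.card ≤ n := by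
      have h1 : X.card = ∑ t ∈ range n, (X.filter fun k => h k = t).card :=
        card_eq_sum_card_fiberwise fun k hk => mem_coe.2 (mem_range.2 (hh k (mem_filter.1 hk).1))
      have h2 : X.card ≤ ∑ t ∈ range n, if t ∈ bigBags a n σ then 0 else 1 :=
        h1.trans_le (sum_le_sum fun t ht => hXcard t (mem_range.1 ht))
      have h3 : (∑ t ∈ range n, if t ∈ bigBags a n σ then 0 else 1) =
          ((range n).filter fun t => t ∉ bigBags a n σ).card := by
        rw [card_filter]
        exact sum_congr rfl fun t _ => by by_cases ht : t ∈ bigBags a n σ <;> simp [ht]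
      have h4 : ((range n).filter fun t => t ∈ bigBags a n σ) = bigBags a n σ := by
        ext t
        simp only [mem_filter, mem_range, and_iff_right_iff_imp]
        exact fun ht => (mem_bigBags.1 ht).1
      have h5 := card_filter_add_card_filter_not (s := range n) (fun t => t ∈ bigBags a n σ)
      rw [card_range, h4] at h5
      omega
    have hineq := hp.sum_excess_le (X := X) hL (by omega) hσ0.le (by linarith) hf (by linarith)
      (filter_subset _ _) (by omega)
    have hXsum : ∑ k ∈ X, (a k - σ) = ∑ t ∈ range n, ∑ k ∈ F t with σ ≤ a k, (a k - σ) := by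
      rw [← sum_fiberwise_of_maps_to (t := range n) (g := h)
        (fun k hk => mem_range.2 (hh k (mem_filter.1 hk).1))]
      exact sum_congr rfl fun t _ => by rw [hFX]
    have hAsum : ∑ t ∈ bigBags a n σ, (a t + a (2 * n - 1 - t) - 1 - σ) =
        ∑ t ∈ range n, if t ∈ bigBags a n σ then a t + a (2 * n - 1 - t) - 1 - σ else 0 := by
      rw [← sum_filter]
      congr 1
      ext t
      simp only [mem_filter, mem_range, iff_and_self]
      exact fun ht => (mem_bigBags.1 ht).1
    have hXnn : ∀ t, 0 ≤ ∑ k ∈ F t with σ ≤ a k, (a k - σ) := fun t =>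
      sum_nonneg fun k hk => sub_nonneg.2 (mem_filter.1 hk).2
    have hlt : ∑ t ∈ range n, (a t + a (2 * n - 1 - t) + ∑ k ∈ F t, a k) <
        ∑ t ∈ range n, ((if t ∈ bigBags a n σ then a t + a (2 * n - 1 - t) - 1 - σ else 0) +
          ∑ k ∈ F t with σ ≤ a k, (a k - σ) + (1 + σ)) := by
      refine sum_lt_sum (fun t ht => ?_) ⟨f₀, mem_range.2 hf₀, ?_⟩
      · have ht := mem_range.1 ht
        split_ifs with htA
        · rw [(hAF t htA).1]; simp
        · by_cases htf : t = f₀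
          · subst htf; linarith [hXnn t]
          rcases hbag' t ht htf with he | ⟨g, hg, hlt⟩
          · have : a t + a (2 * n - 1 - t) ≤ 1 + σ := by
              by_contra! hlt; exact htA (mem_bigBags.2 ⟨ht, hlt⟩)
            rw [he]; simpa using this
          · rcases le_or_gt σ (a g) with hgσ | hgσ
            · have := single_le_sum (f := fun k => a k - σ)
                (fun k hk => sub_nonneg.2 (mem_filter.1 hk).2)
                (mem_filter.2 ⟨hg, hgσ⟩ : g ∈ (F t).filter fun k => σ ≤ a k)
              linarith
            · linarith [hXnn t]
      · rw [if_neg fun htA => (hAF f₀ htA).2 rfl]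
        linarith [hXnn f₀]
    rw [← htot', sum_add_distrib, sum_add_distrib, ← hAsum, ← hXsum, sum_const, card_range,
      nsmul_eq_mul] at hlt
    have hD : ((d - n : ℕ) : ℝ) = d - n := by rw [Nat.cast_sub (by omega)]
    rw [hD] at hineq
    -- `d < n(1 + σ) + (d - n)(1 - 3σ)` would give `3(d - n) < n`.
    nlinarith

end Packing

/-! ### Normalising a share partition -/

/-- A nonincreasing sequence of sizes and bins of total size at least `μ` can be replaced by a full
packing into bins of size one whose items are smaller, in units of `μ`. -/
theorem exists_full_packing {d L : ℕ} {w : ℕ → ℝ} (hw : Antitone w) (hw0 : ∀ k, 0 ≤ w k) {μ : ℝ}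
    (hμ : 0 < μ) (c : ℕ → Fin d) (hc : ∀ j, μ ≤ ∑ k ∈ range L with c k = j, w k) :
    ∃ (a : ℕ → ℝ) (c' : ℕ → Fin d), Packing d L a c' ∧ ∑ k ∈ range L, a k = d ∧
      ∀ k < L, μ * a k ≤ w k := by
  set s : Fin d → ℝ := fun j => ∑ k ∈ range L with c k = j, w k with hs
  have hs0 : ∀ j, 0 < s j := fun j => hμ.trans_le (hc j)
  -- Every bin is scaled to size exactly 1. This destroys the order, so the items are sorted again.
  set x : Fin L → ℝ := fun k => w k / s (c k) with hx
  have hx0 : ∀ k, 0 ≤ x k := fun k => div_nonneg (hw0 _) (hs0 _).le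
  set σ : Equiv.Perm (Fin L) := Tuple.sort fun k => -x k with hσ
  have hmono : ∀ k l : Fin L, k ≤ l → x (σ l) ≤ x (σ k) := fun k l hkl =>
    neg_le_neg_iff.1 (Tuple.monotone_sort (fun k => -x k) hkl)
  set a : ℕ → ℝ := fun k => if hk : k < L then x (σ ⟨k, hk⟩) else 0 with ha
  set c' : ℕ → Fin d := fun k => if hk : k < L then c (σ ⟨k, hk⟩) else c k with hc'
  have hbin : ∀ j, ∑ k ∈ range L with c' k = j, a k = 1 := by
    intro j
    rw [sum_filter, sum_range]
    have h1 : ∀ k : Fin L, (if c' k = j then a k else 0) =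
        (fun k : Fin L => if c k = j then x k else 0) (σ k) := fun k => by simp [ha, hc']
    rw [sum_congr rfl fun k _ => h1 k, Equiv.sum_comp σ (fun k : Fin L => if c k = j then x k else 0)]
    have h2 : ∀ k : Fin L, (if c k = j then x k else 0) =
        (if c k = j then w k else 0) / s j := fun k => by
      split_ifs with h
      · rw [hx, ← h]
      · simp
    rw [sum_congr rfl fun k _ => h2 k, ← sum_div,
      ← sum_range (fun k => if c k = j then w k else 0), ← sum_filter]
    exact div_self (hs0 j).ne'
  refine ⟨a, c', ⟨?_, ?_, fun j => (hbin j).le⟩, ?_, ?_⟩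
  · intro k l hkl
    simp only [ha]
    split_ifs with h1 h2 h2
    · exact hmono _ _ hkl
    · omega
    · exact hx0 _
    · exact le_rfl
  · intro k
    simp only [ha]
    split_ifs
    exacts [hx0 _, le_rfl]
  · rw [← sum_fiberwise (range L) c' a, sum_congr rfl fun j _ => hbin j]
    simp
  · intro k hk
    -- By pigeonhole, one of the `k + 1` largest scaled items was originally at position `k` or
    -- later.
    obtain ⟨r, hrk, hkr⟩ : ∃ r : Fin L, (r : ℕ) ≤ k ∧ k ≤ (σ r : ℕ) := by
      by_contra! hlt
      have h1 : ((Iic (⟨k, hk⟩ : Fin L)).map σ.toEmbedding).card ≤ (Iio (⟨k, hk⟩ : Fin L)).card := by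
        refine card_le_card fun l hl => ?_
        obtain ⟨r, hr, rfl⟩ := mem_map.1 hl
        have hr' : r ≤ ⟨k, hk⟩ := mem_Iic.1 hr
        exact mem_Iio.2 (hlt r hr')
      rw [card_map, Fin.card_Iic, Fin.card_Iio] at h1
      simp at h1
    have h1 := hmono r ⟨k, hk⟩ hrk
    have h2 : μ * x (σ r) ≤ w (σ r) := by
      have h3 := hs0 (c (σ r))
      have h4 : x (σ r) * s (c (σ r)) = w (σ r) := div_mul_cancel₀ _ h3.ne'
      have h5 := mul_le_mul_of_nonneg_left (hc (c (σ r))) (hx0 (σ r))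
      linarith
    have h3 := hw hkr
    have h4 := mul_le_mul_of_nonneg_left h1 hμ.le
    simp only [ha, hk, dite_true]
    linarith

/-! ### Completing a partial EF1 allocation -/

variable {N G T : Type*}

section Completion

variable [DecidableEq G] {w : N → G → ℝ} {μ : N → ℝ}

/-- A partial allocation of the goods that is envy-free up to one good and gives every agent `i` a
bundle of value at least `μ i`; the values are given by the weights `w i`. -/
structure EF1Alloc (w : N → G → ℝ) (μ : N → ℝ) (A : N → Finset G) : Prop where
  disj : ∀ i j g, g ∈ A i → g ∈ A j → i = j
  le : ∀ i, μ i ≤ ∑ g ∈ A i, w i g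
  ef1 : ∀ i j, ∑ g ∈ A j, w i g ≤ ∑ g ∈ A i, w i g ∨
    ∃ g ∈ A j, ∑ k ∈ (A j).erase g, w i k ≤ ∑ k ∈ A i, w i k

namespace EF1Alloc

variable {A : N → Finset G}

/-- Removing the new good `g` restores a bundle that nobody envied. -/
theorem insert_of_unenvied [DecidableEq N] (h : EF1Alloc w μ A) (hw : ∀ i g, 0 ≤ w i g) {g : G}
    (hg : ∀ i, g ∉ A i) {j : N} (hj : ∀ i, ∑ g ∈ A j, w i g ≤ ∑ g ∈ A i, w i g) :
    EF1Alloc w μ (Function.update A j (insert g (A j))) := by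
  have hmono : ∀ i, ∑ k ∈ A i, w i k ≤ ∑ k ∈ Function.update A j (insert g (A j)) i, w i k := by
    intro i
    refine sum_le_sum_of_subset_of_nonneg ?_ fun k _ _ => hw i k
    by_cases hij : i = j
    · subst hij; simp
    · simp [hij]
  refine ⟨fun i i' k hk hk' => ?_, fun i => (h.le i).trans (hmono i), fun i i' => ?_⟩
  · by_cases hij : i = j <;> by_cases hij' : i' = j
    · rw [hij, hij']
    · subst hij
      simp only [Function.update_self, mem_insert, Function.update_of_ne hij'] at hk hk'
      rcases hk with rfl | hk
      · exact absurd hk' (hg i')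
      · exact h.disj _ _ _ hk hk'
    · subst hij'
      simp only [Function.update_self, mem_insert, Function.update_of_ne hij] at hk hk'
      rcases hk' with rfl | hk'
      · exact absurd hk (hg i)
      · exact h.disj _ _ _ hk hk'
    · rw [Function.update_of_ne hij] at hk
      rw [Function.update_of_ne hij'] at hk'
      exact h.disj _ _ _ hk hk'
  · by_cases hij' : i' = j
    · subst hij'
      refine Or.inr ⟨g, by simp, ?_⟩
      rw [Function.update_self, erase_insert (hg _)]
      exact (hj i).trans (hmono i)
    · rw [Function.update_of_ne hij']
      rcases h.ef1 i i' with h1 | ⟨k, hk, h1⟩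
      · exact Or.inl (h1.trans (hmono i))
      · exact Or.inr ⟨k, hk, h1.trans (hmono i)⟩

theorem comp (h : EF1Alloc w μ A) {π : N → N} (hπ : Function.Injective π)
    (hle : ∀ i, ∑ g ∈ A i, w i g ≤ ∑ g ∈ A (π i), w i g) : EF1Alloc w μ (A ∘ π) := by
  refine ⟨fun i j g hi hj => hπ (h.disj _ _ g hi hj), fun i => (h.le i).trans (hle i),
    fun i j => ?_⟩
  rcases h.ef1 i (π j) with h1 | ⟨g, hg, h1⟩
  · exact Or.inl (h1.trans (hle i))
  · exact Or.inr ⟨g, hg, h1.trans (hle i)⟩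

end EF1Alloc

/-- A self-map of a finite type is inverted on its cycles by a permutation. -/
theorem exists_injective_rotation [Finite N] [Nonempty N] (φ : N → N) :
    ∃ π : N → N, Function.Injective π ∧ (∀ i, φ (π i) = i ∨ π i = i) ∧ ∃ i, φ (π i) = i := by
  classical
  set C := Function.periodicPts φ with hC
  have hsurj : ∀ i ∈ C, ∃ j ∈ C, φ j = i := fun i hi => (Function.bijOn_periodicPts φ).surjOn hi
  choose! ψ hψC hψ using hsurj
  refine ⟨fun i => if i ∈ C then ψ i else i, fun i j hij => ?_, fun i => ?_, ?_⟩
  · simp only at hij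
    split_ifs at hij with hi hj hj
    · rw [← hψ i hi, hij, hψ j hj]
    · exact absurd (hij ▸ hψC i hi) hj
    · exact absurd (hij ▸ hψC j hj) hi
    · exact hij
  · by_cases hi : i ∈ C
    · simp [hi, hψ]
    · simp [hi]
  · obtain ⟨x⟩ := ‹Nonempty N›
    obtain ⟨p, q, hpq, he⟩ := Finite.exists_ne_map_eq_of_infinite fun k => φ^[k] x
    wlog hlt : p < q generalizing p q
    · exact this q p hpq.symm he.symm (by omega)
    have hper : φ^[p] x ∈ C := by
      refine Function.mk_mem_periodicPts (n := q - p) (by omega) ?_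
      rw [Function.IsPeriodicPt, Function.IsFixedPt, ← Function.iterate_add_apply,
        show q - p + p = q by omega]
      exact he.symm
    exact ⟨φ^[p] x, by simp [hper, hψ]⟩

/-- Envy-cycle elimination: a partial allocation can be completed. -/
theorem EF1Alloc.exists_complete [Finite N] [Nonempty N] [Finite G] (hw : ∀ i g, 0 ≤ w i g)
    {A₀ : N → Finset G} (h₀ : EF1Alloc w μ A₀) :
    ∃ A : N → Finset G, EF1Alloc w μ A ∧ ∀ g, ∃ i, g ∈ A i := by
  classical
  have := Fintype.ofFinite N
  -- Giving a good to an unenvied agent raises the first component; rotating bundles along envy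
  -- cycles preserves it and raises the second.
  obtain ⟨A, hA, hmax⟩ := Set.exists_max_image {A : N → Finset G | EF1Alloc w μ A}
    (fun A => toLex (∑ i, (A i).card, ∑ i, ∑ g ∈ A i, w i g)) (Set.toFinite _) ⟨A₀, h₀⟩
  refine ⟨A, hA, fun g => ?_⟩
  by_contra! hg
  have hA : EF1Alloc w μ A := hA
  by_cases hun : ∃ j, ∀ i, ∑ g ∈ A j, w i g ≤ ∑ g ∈ A i, w i g
  · obtain ⟨j, hj⟩ := hun
    refine (hmax _ (hA.insert_of_unenvied hw hg hj)).not_gt ?_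
    rw [Prod.Lex.toLex_lt_toLex]
    left
    refine sum_lt_sum (fun i _ => card_le_card ?_) ⟨j, mem_univ _, ?_⟩
    · by_cases hij : i = j
      · subst hij; simp
      · simp [hij]
    · simp [card_insert_of_notMem (hg j)]
  · push Not at hun
    choose φ hφ using hun
    obtain ⟨π, hπ, hπφ, i₀, hi₀⟩ := exists_injective_rotation φ
    have hlt : ∀ i, φ (π i) = i → ∑ g ∈ A i, w i g < ∑ g ∈ A (π i), w i g := fun i hi => by
      have := hφ (π i)
      rwa [hi] at this
    have hle : ∀ i, ∑ g ∈ A i, w i g ≤ ∑ g ∈ A (π i), w i g := fun i => by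
      rcases hπφ i with hi | hi
      · exact (hlt i hi).le
      · rw [hi]
    refine (hmax _ (hA.comp hπ hle)).not_gt ?_
    rw [Prod.Lex.toLex_lt_toLex]
    right
    refine ⟨?_, sum_lt_sum (fun i _ => hle i) ⟨i₀, mem_univ _, hlt i₀ hi₀⟩⟩
    exact (Equiv.sum_comp (Equiv.ofBijective π (Finite.injective_iff_bijective.1 hπ))
      fun i => (A i).card).symm

end Completion

/-! ### Bag filling -/

section BagFilling

variable [DecidableEq G] {w : N → G → ℝ} {μ : N → ℝ} {base : G → Option T} {Y : T → Finset G}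
  {o : N → Option T}

/-- Given bags `Y`, some of which are assigned to agents by `o`, agent `i` does not want the bundle
`S`: it does not suffice for her if she has no bag, and otherwise she does not envy it. -/
structure Unwanted (w : N → G → ℝ) (μ : N → ℝ) (Y : T → Finset G) (o : N → Option T) (i : N)
    (S : Finset G) : Prop where
  lt : o i = none → ∑ g ∈ S, w i g < μ i
  le : ∀ t, o i = some t → ∑ g ∈ S, w i g ≤ ∑ g ∈ Y t, w i g

/-- The configurations of the bag filling algorithm. The goods `g` with `base g = some t` can only
be put into the bag `t`, before any good `k` with `base k = none`. -/
structure BagConfig (w : N → G → ℝ) (μ : N → ℝ) (base : G → Option T) (Y : T → Finset G)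
    (o : N → Option T) : Prop where
  disj : ∀ s t g, g ∈ Y s → g ∈ Y t → s = t
  base_eq : ∀ t g s, g ∈ Y t → base g = some s → s = t
  base_mem : ∀ t g k, g ∈ Y t → base g = none → base k = some t → k ∈ Y t
  inj : ∀ i j t, o i = some t → o j = some t → i = j
  le : ∀ i t, o i = some t → μ i ≤ ∑ g ∈ Y t, w i g
  ef : ∀ t, (Y t).Nonempty → ∃ g ∈ Y t, ((∃ k ∈ Y t, base k = none) → base g = none) ∧
    ∀ i, Unwanted w μ Y o i ((Y t).erase g)

namespace BagConfig

/-- Agent `i` ends up at least as well off, so whatever was unwanted stays unwanted. Her former bag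
becomes free. -/
theorem assign [DecidableEq N] (h : BagConfig w μ base Y o) {i : N} {f : T} (hf : ∀ j, o j ≠ some f)
    (hμ : μ i ≤ ∑ g ∈ Y f, w i g)
    (hlt : ∀ t, o i = some t → ∑ g ∈ Y t, w i g ≤ ∑ g ∈ Y f, w i g) :
    BagConfig w μ base Y (Function.update o i (some f)) := by
  refine ⟨h.disj, h.base_eq, h.base_mem, fun j k t hj hk => ?_, fun j t hj => ?_, fun t ht => ?_⟩
  · by_cases hji : j = i <;> by_cases hki : k = i
    · rw [hji, hki]
    · subst hji
      rw [Function.update_self] at hj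
      rw [Function.update_of_ne hki, ← hj] at hk
      exact absurd hk (hf k)
    · subst hki
      rw [Function.update_self] at hk
      rw [Function.update_of_ne hji, ← hk] at hj
      exact absurd hj (hf j)
    · rw [Function.update_of_ne hji] at hj
      rw [Function.update_of_ne hki] at hk
      exact h.inj j k t hj hk
  · by_cases hji : j = i
    · subst hji
      rw [Function.update_self, Option.some_inj] at hj
      exact hj ▸ hμ
    · rw [Function.update_of_ne hji] at hj
      exact h.le j t hj
  · obtain ⟨g, hg, hg1, hg2⟩ := h.ef t ht
    refine ⟨g, hg, hg1, fun j => ?_⟩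
    by_cases hji : j = i
    · subst hji
      refine ⟨fun hj => by simp at hj, fun s hs => ?_⟩
      rw [Function.update_self, Option.some_inj] at hs
      subst hs
      cases hoj : o j with
      | none => exact ((hg2 j).lt hoj).le.trans hμ
      | some s => exact ((hg2 j).le s hoj).trans (hlt s hoj)
    · refine ⟨fun hj => (hg2 j).lt ?_, fun s hs => (hg2 j).le s ?_⟩
      · rwa [Function.update_of_ne hji] at hj
      · rwa [Function.update_of_ne hji] at hs

/-- The new good serves as the witness in `ef` for bag `f`, since the bag without it was unwanted.
As later goods enter only after the initial ones, it has the required kind. -/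
theorem insert [DecidableEq T] (h : BagConfig w μ base Y o) {f : T} (hf : ∀ j, o j ≠ some f)
    (hun : ∀ i, Unwanted w μ Y o i (Y f)) {g : G} (hg : ∀ t, g ∉ Y t)
    (hbase : base g = some f ∧ (∀ k ∈ Y f, base k ≠ none) ∨
      base g = none ∧ ∀ k, base k = some f → k ∈ Y f) :
    BagConfig w μ base (Function.update Y f (insert g (Y f))) o := by
  have hself : Function.update Y f (Insert.insert g (Y f)) f = Insert.insert g (Y f) :=
    Function.update_self ..
  have hne : ∀ t, t ≠ f → Function.update Y f (Insert.insert g (Y f)) t = Y t := fun t ht =>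
    Function.update_of_ne ht ..
  have hun' : ∀ i S, Unwanted w μ Y o i S →
      Unwanted w μ (Function.update Y f (Insert.insert g (Y f))) o i S := fun i S hS =>
    ⟨hS.lt, fun t ht => by
      rw [hne t (by rintro rfl; exact hf i ht)]
      exact hS.le t ht⟩
  refine ⟨fun s t k hs ht => ?_, fun t k s hk hs => ?_, fun t k l hk hkb hl => ?_, h.inj,
    fun i t ht => ?_, fun t ht => ?_⟩
  · by_cases hsf : s = f <;> by_cases htf : t = f
    · rw [hsf, htf]
    · subst hsf
      rw [hself, mem_insert] at hs
      rw [hne t htf] at ht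
      rcases hs with rfl | hs
      · exact absurd ht (hg t)
      · exact h.disj _ _ _ hs ht
    · subst htf
      rw [hself, mem_insert] at ht
      rw [hne s hsf] at hs
      rcases ht with rfl | ht
      · exact absurd hs (hg s)
      · exact h.disj _ _ _ hs ht
    · rw [hne s hsf] at hs
      rw [hne t htf] at ht
      exact h.disj _ _ _ hs ht
  · by_cases htf : t = f
    · subst htf
      rw [hself, mem_insert] at hk
      rcases hk with rfl | hk
      · rcases hbase with ⟨hb, -⟩ | ⟨hb, -⟩
        · rw [hb] at hs
          exact (Option.some_inj.1 hs).symm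
        · rw [hb] at hs
          exact absurd hs (by simp)
      · exact h.base_eq t k s hk hs
    · rw [hne t htf] at hk
      exact h.base_eq t k s hk hs
  · by_cases htf : t = f
    · subst htf
      rw [hself, mem_insert] at hk ⊢
      right
      rcases hk with rfl | hk
      · rcases hbase with ⟨hb, -⟩ | ⟨-, hb⟩
        · rw [hb] at hkb
          exact absurd hkb (by simp)
        · exact hb l hl
      · exact h.base_mem t k l hk hkb hl
    · rw [hne t htf] at hk ⊢
      exact h.base_mem t k l hk hkb hl
  · rw [hne t (by rintro rfl; exact hf i ht)]
    exact h.le i t ht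
  · by_cases htf : t = f
    · subst htf
      rw [hself]
      refine ⟨g, mem_insert_self _ _, ?_, fun i => ?_⟩
      · rintro ⟨k, hk, hkb⟩
        rcases mem_insert.1 hk with rfl | hk
        · exact hkb
        · rcases hbase with ⟨-, hb⟩ | ⟨hb, -⟩
          · exact absurd hkb (hb k hk)
          · exact hb
      · rw [erase_insert (hg t)]
        exact hun' i _ (hun i)
    · rw [hne t htf] at ht ⊢
      obtain ⟨k, hk, hk1, hk2⟩ := h.ef t ht
      exact ⟨k, hk, hk1, fun i => hun' i _ (hk2 i)⟩

theorem ef1Alloc (h : BagConfig w μ base Y o) (hw : ∀ i g, 0 ≤ w i g) {b : N → T} (hb : ∀ i, o i = some (b i)) :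
    EF1Alloc w μ (Y ∘ b) := by
  refine ⟨fun i j g hi hj => ?_, fun i => h.le i _ (hb i), fun i j => ?_⟩
  · have h1 : b i = b j := h.disj _ _ _ hi hj
    exact h.inj i j (b j) (by rw [hb, h1]) (hb j)
  · rcases (Y (b j)).eq_empty_or_nonempty with he | hne
    · left
      simpa [he] using sum_nonneg fun g _ => hw i g
    · obtain ⟨g, hg, -, hg'⟩ := h.ef _ hne
      exact Or.inr ⟨g, hg, (hg' i).le _ (hb i)⟩

/-- Either the bag filling algorithm provides every agent with a bag, or it gets stuck with a bag
`f` that an agent `i` without a bag does not want. -/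
theorem exists_ef1Alloc_or_stuck [Finite G] [Fintype N] [Fintype T]
    (hcard : Fintype.card N ≤ Fintype.card T) {w : N → G → ℝ} (hw : ∀ i g, 0 ≤ w i g) (μ : N → ℝ) (base : G → Option T) :
    (∃ A, EF1Alloc w μ A) ∨ ∃ (Y : T → Finset G) (o : N → Option T) (i : N) (f : T),
      BagConfig w μ base Y o ∧ o i = none ∧ ∑ g ∈ Y f, w i g < μ i ∧
      (∀ g, base g = some f → g ∈ Y f) ∧ ∀ g, base g = none → ∃ t, g ∈ Y t := by
  classical
  -- The process is replaced by a maximal configuration: inserting a good raises the first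
  -- component, serving a new agent the second, and exchanging a bag for a better one the third.
  obtain ⟨⟨Y, o⟩, hYo, hmax⟩ := Set.exists_max_image
    {p : (T → Finset G) × (N → Option T) | BagConfig w μ base p.1 p.2}
    (fun p => toLex (∑ t, (p.1 t).card, toLex (#{i | p.2 i ≠ none},
      ∑ i, (p.2 i).elim 0 fun t => ∑ g ∈ p.1 t, w i g))) (Set.toFinite _)
    ⟨(fun _ => ∅, fun _ => none), by constructor <;> simp⟩
  have h : BagConfig w μ base Y o := hYo
  by_cases hall : ∀ i, o i ≠ none
  · left
    choose b hb using fun i => Option.ne_none_iff_exists'.1 (hall i)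
    exact ⟨_, h.ef1Alloc hw hb⟩
  right
  push Not at hall
  obtain ⟨i, hi⟩ := hall
  obtain ⟨f, hf⟩ : ∃ f, ∀ j, o j ≠ some f := by
    by_contra! hno
    choose j hj using hno
    have hinj : Function.Injective j := fun s t hst => by
      have := hj s
      rw [hst, hj t] at this
      exact (Option.some_inj.1 this).symm
    have hsurj := (Fintype.bijective_iff_injective_and_card j).2
      ⟨hinj, (Fintype.card_le_of_injective j hinj).antisymm hcard⟩ |>.2
    obtain ⟨t, rfl⟩ := hsurj i
    rw [hj] at hi
    exact absurd hi (by simp)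
  have hun : ∀ j, Unwanted w μ Y o j (Y f) := by
    intro j
    refine ⟨fun hj => ?_, fun t ht => ?_⟩
    · by_contra! hle
      refine (hmax (Y, Function.update o j (some f)) (h.assign hf hle fun t ht => by rw [hj] at ht; simp at ht)).not_gt ?_
      rw [Prod.Lex.toLex_lt_toLex]
      right
      refine ⟨rfl, ?_⟩
      rw [Prod.Lex.toLex_lt_toLex]
      left
      refine card_lt_card (Finset.ssubset_iff_of_subset ?_ |>.2 ⟨j, ?_, ?_⟩)
      · intro k hk
        rw [mem_filter] at hk ⊢
        refine ⟨mem_univ _, ?_⟩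
        by_cases hkj : k = j
        · subst hkj; simp
        · simpa [hkj] using hk.2
      · simp
      · simp [hj]
    · by_contra! hlt
      refine (hmax (Y, Function.update o j (some f)) (h.assign hf ((h.le j t ht).trans hlt.le) fun s hs => by
        rw [ht, Option.some_inj] at hs; exact hs ▸ hlt.le)).not_gt ?_
      rw [Prod.Lex.toLex_lt_toLex]
      right
      refine ⟨rfl, ?_⟩
      rw [Prod.Lex.toLex_lt_toLex]
      right
      refine ⟨?_, sum_lt_sum (fun k _ => ?_) ⟨j, mem_univ _, ?_⟩⟩
      · refine congrArg card (filter_congr fun k _ => ?_)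
        by_cases hkj : k = j
        · subst hkj; simp [ht]
        · simp [hkj]
      · by_cases hkj : k = j
        · subst hkj; simpa [ht] using hlt.le
        · simp [hkj]
      · simpa [ht] using hlt
  have hins : ∀ g, (∀ t, g ∉ Y t) → ¬ (base g = some f ∧ (∀ k ∈ Y f, base k ≠ none) ∨
      base g = none ∧ ∀ k, base k = some f → k ∈ Y f) := by
    intro g hg hb
    refine (hmax (Function.update Y f (Insert.insert g (Y f)), o) (h.insert hf hun hg hb)).not_gt ?_
    rw [Prod.Lex.toLex_lt_toLex]
    left
    refine sum_lt_sum (fun t _ => card_le_card ?_) ⟨f, mem_univ _, ?_⟩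
    · by_cases htf : t = f
      · subst htf; simp
      · simp [htf]
    · simp [card_insert_of_notMem (hg f)]
  have hbase : ∀ g, base g = some f → g ∈ Y f := by
    intro g hg
    by_contra hgf
    refine hins g (fun t ht => hgf ?_) (Or.inl ⟨hg, fun k hk hkb => hgf ?_⟩)
    · rwa [h.base_eq t g f ht hg]
    · exact h.base_mem f k g hk hkb hg
  refine ⟨Y, o, i, f, h, hi, (hun i).lt hi, hbase, fun g hg => ?_⟩
  by_contra! hgY
  exact hins g hgY (Or.inr ⟨hg, hbase⟩)

end BagConfig

end BagFilling

/-! ### Excluding the stuck case and the main theorem -/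

/-- The bag that contains the item `k` at the outset: `{t, 2 * n - 1 - t}` for `t < n`. -/
def baseBag (n L : ℕ) (k : Fin L) : Option (Fin n) :=
  if h : (k : ℕ) < n then some ⟨k, h⟩
  else if h' : (k : ℕ) < 2 * n then some ⟨2 * n - 1 - k, by omega⟩ else none

theorem baseBag_eq_none {n L : ℕ} {k : Fin L} : baseBag n L k = none ↔ 2 * n ≤ k := by
  unfold baseBag
  split_ifs <;> simp <;> omega

theorem baseBag_eq_some {n L : ℕ} {k : Fin L} {t : Fin n} :
    baseBag n L k = some t ↔ (k : ℕ) = t ∨ (k : ℕ) = 2 * n - 1 - t := by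
  have := t.2
  unfold baseBag
  split_ifs <;> simp [Fin.ext_iff] <;> omega

/-- When bag filling is stuck, an agent without a bag finds every nonempty bag insufficient after
the removal of a suitable good, and bag `f` insufficient as it is; in her normalised sizes this is
excluded by `not_stuck`. -/
theorem exists_complete_of_antitone [Fintype N] [Nonempty N] {d L : ℕ}
    (hL : 2 * Fintype.card N ≤ L) (hd : 4 * Fintype.card N ≤ 3 * d) {w : N → ℕ → ℝ}
    (hw : ∀ i, Antitone (w i)) (hw0 : ∀ i k, 0 ≤ w i k) {μ : N → ℝ}
    (hμ : ∀ i, ∃ c : ℕ → Fin d, ∀ j, μ i ≤ ∑ k ∈ range L with c k = j, w i k) :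
    ∃ A : N → Finset (Fin L), EF1Alloc (fun i (k : Fin L) => w i k) μ A ∧ ∀ g, ∃ i, g ∈ A i := by
  classical
  set n := Fintype.card N with hn
  rcases BagConfig.exists_ef1Alloc_or_stuck (T := Fin n) (by simp [hn])
    (w := fun i (k : Fin L) => w i k) (fun i k => hw0 i k) μ (baseBag n L) with
    ⟨A, hA⟩ | ⟨Y, o, i, f, hY, hoi, hYf, hbase, hfill⟩
  · exact hA.exists_complete fun i (k : Fin L) => hw0 i k
  exfalso
  have hμ0 : 0 < μ i := (sum_nonneg fun (k : Fin L) _ => hw0 i k).trans_lt hYf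
  obtain ⟨c, hc⟩ := hμ i
  obtain ⟨a, c', hp, htot, ha⟩ := exists_full_packing (hw i) (hw0 i) hμ0 c hc
  have hlt : ∀ S : Finset (Fin L), ∑ k ∈ S, w i k < μ i → ∑ k ∈ S, a k < 1 := by
    intro S hS
    have h1 : μ i * ∑ k ∈ S, a k ≤ ∑ k ∈ S, w i k := by
      rw [mul_sum]
      exact sum_le_sum fun k _ => ha k k.2
    by_contra! hle
    have := mul_le_mul_of_nonneg_left hle hμ0.le
    linarith
  have hfill' : ∀ k ∈ Ico (2 * n) L, ∃ t : Fin n, ∃ hk : k < L, (⟨k, hk⟩ : Fin L) ∈ Y t := by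
    intro k hk
    obtain ⟨hk1, hk2⟩ := mem_Ico.1 hk
    obtain ⟨t, ht⟩ := hfill ⟨k, hk2⟩ (baseBag_eq_none.2 hk1)
    exact ⟨t, hk2, ht⟩
  have : Nonempty (Fin n) := ⟨f⟩
  choose! h hhL hh using hfill'
  have hsum : ∀ t : Fin n, (∀ k, baseBag n L k = some t → k ∈ Y t) →
      a t + a (2 * n - 1 - t) + ∑ k ∈ Ico (2 * n) L with (h k : ℕ) = t, a k ≤ ∑ k ∈ Y t, a k := by
    intro t ht
    have ht2 := t.2
    have h1 : ∑ k ∈ Y t, a k = ∑ k ∈ (Y t).map Fin.valEmbedding, a k := by simp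
    have hdis : Disjoint {(t : ℕ), 2 * n - 1 - t}
        ((Ico (2 * n) L).filter fun k => (h k : ℕ) = t) := by
      rw [disjoint_left]
      intro k hk hk'
      have := (mem_Ico.1 (mem_filter.1 hk').1).1
      simp only [mem_insert, mem_singleton] at hk
      omega
    rw [h1, ← sum_pair (f := a) (show (t : ℕ) ≠ 2 * n - 1 - t by omega), ← sum_union hdis]
    refine sum_le_sum_of_subset_of_nonneg (fun k hk => ?_) fun k _ _ => hp.nonneg k
    rw [mem_map]
    rcases mem_union.1 hk with hk | hk
    · simp only [mem_insert, mem_singleton] at hk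
      exact ⟨⟨k, by omega⟩, ht _ (baseBag_eq_some.2 hk), rfl⟩
    · obtain ⟨hk, hkt⟩ := mem_filter.1 hk
      exact ⟨⟨k, hhL k hk⟩, Fin.ext hkt ▸ hh k hk, rfl⟩
  refine hp.not_stuck (h := fun k => h k) (f₀ := f) htot hL hd (fun k _ => (h k).2) f.2
    (fun t ht _ => ?_) ((hsum f hbase).trans_lt (hlt _ hYf))
  obtain ⟨t, rfl⟩ : ∃ t' : Fin n, t = t' := ⟨⟨t, ht⟩, rfl⟩
  -- A bag with a later good contains both of its initial goods, and its removable good is a later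
  -- one. A bag without later goods may still be incomplete, and nothing is required of it.
  by_cases hex : ∃ k ∈ Ico (2 * n) L, h k = t
  · right
    obtain ⟨k, hk, rfl⟩ := hex
    obtain ⟨g, hg, hg1, hg2⟩ := hY.ef _ ⟨_, hh k hk⟩
    have hk' : baseBag n L ⟨k, hhL k hk⟩ = none := baseBag_eq_none.2 (mem_Ico.1 hk).1
    have hg' := baseBag_eq_none.1 (hg1 ⟨_, hh k hk, hk'⟩)
    have hgI : (g : ℕ) ∈ Ico (2 * n) L := mem_Ico.2 ⟨hg', g.2⟩
    refine ⟨g, hgI, ?_, ?_⟩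
    · exact congrArg Fin.val (hY.disj _ _ _ (hh g hgI) hg)
    · have h1 := hlt _ ((hg2 i).lt hoi)
      have h2 := hsum (h k) fun l hl => hY.base_mem _ _ l (hh k hk) hk' hl
      have h3 := add_sum_erase _ (fun k : Fin L => a k) hg
      linarith
  · left
    intro k hk hkt
    exact hex ⟨k, hk, Fin.ext hkt⟩

end FairDivision

theorem theorem3 {N M : Type*} [Fintype N] [Nonempty N] [Fintype M] [DecidableEq M]
    (I : FairDivision.Instance N M) (hI : I.IsOrdered) :
    ∃ A : N → Finset M, FairDivision.IsPartition A ∧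
      I.IsOneOutOfMMS (4 * ⌈(Fintype.card N : ℚ) / 3⌉₊) A ∧ I.IsEF1 A := by
  open FairDivision in
  open Finset in
  obtain ⟨e, he⟩ := hI
  set n := Fintype.card N with hn
  have hn0 : 0 < n := Fintype.card_pos
  set d := 4 * ⌈(n : ℚ) / 3⌉₊ with hd
  have hnd : 4 * n ≤ 3 * d := by
    have h1 := Nat.le_ceil ((n : ℚ) / 3)
    have h2 : (n : ℚ) ≤ 3 * (⌈(n : ℚ) / 3⌉₊ : ℚ) := by linarith
    have h3 : n ≤ 3 * ⌈(n : ℚ) / 3⌉₊ := by exact_mod_cast h2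
    omega
  have hd0 : 0 < d := by omega
  set w : N → ℕ → ℝ := fun i k => if hk : k < Fintype.card M then I.v i {e ⟨k, hk⟩} else 0 with hw
  have hw0 : ∀ i k, 0 ≤ w i k := fun i k => by
    simp only [hw]
    split_ifs
    exacts [I.nonneg _ _, le_rfl]
  have hwa : ∀ i, Antitone (w i) := fun i k l hkl => by
    simp only [hw]
    split_ifs
    · exact he i _ _ hkl
    · omega
    · exact I.nonneg _ _
    · exact le_rfl
  -- Positions beyond the actual goods are dummies of value 0, so that each of the `n` initial bags
  -- has two items.
  set L := max (Fintype.card M) (2 * n) with hL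
  have hmL : Fintype.card M ≤ L := le_max_left _ _
  have hwe : ∀ i g, w i (e.symm g) = I.v i {g} := fun i g => by simp [hw]
  -- the positions of the goods
  let p : M ↪ Fin L := ⟨fun g => ⟨e.symm g, (e.symm g).2.trans_le hmL⟩, fun g g' h => by
    simpa [Fin.val_inj] using h⟩
  have hpv : ∀ g, (p g : ℕ) = e.symm g := fun _ => rfl
  have hwp : ∀ i g, w i (p g) = I.v i {g} := hwe
  have hpr : ∀ i (k : Fin L), (∀ g, p g ≠ k) → w i k = 0 := by
    intro i k hk
    simp only [hw]
    split_ifs with hkm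
    · exact absurd (Fin.ext (by simp [hpv])) (hk (e ⟨k, hkm⟩))
    · rfl
  have hμ : ∀ i, ∃ c : ℕ → Fin d, ∀ j, I.mms d i ≤ ∑ k ∈ range L with c k = j, w i k := by
    intro i
    obtain ⟨B, hB, -, hleast⟩ := (I.isGreatest_mms hd0 i).1
    choose b hb using fun g => (hB g).exists
    refine ⟨fun k => if hk : k < Fintype.card M then b (e ⟨k, hk⟩) else ⟨0, hd0⟩, fun j => ?_⟩
    refine (hleast ⟨j, rfl⟩).trans ?_
    simp only
    rw [I.additive, ← sum_congr rfl fun g _ => hwp i g]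
    refine (sum_map (B j) (p.trans Fin.valEmbedding) (w i)).symm.trans_le ?_
    refine sum_le_sum_of_subset_of_nonneg (fun k hk => ?_) fun k _ _ => hw0 i k
    obtain ⟨g, hg, rfl⟩ := mem_map.1 hk
    refine mem_filter.2 ⟨mem_range.2 (p g).2, ?_⟩
    simpa [hpv] using (hB g).unique (hb g) hg
  obtain ⟨A, hA, hcov⟩ := exists_complete_of_antitone (le_max_right _ _) hnd hwa hw0 hμ
  set A' : N → Finset M := fun i => univ.filter fun g => p g ∈ A i with hA'
  have hval : ∀ i (S : Finset (Fin L)), ∑ k ∈ S, w i k =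
      I.v i (univ.filter fun g => p g ∈ S) := by
    intro i S
    rw [I.additive, ← sum_congr rfl fun g _ => hwp i g, ← sum_map _ p fun k : Fin L => w i k]
    symm
    refine sum_subset (fun k hk => ?_) fun k hk hk' => hpr i k fun g hg => hk' ?_
    · obtain ⟨g, hg, rfl⟩ := mem_map.1 hk
      exact (mem_filter.1 hg).2
    · subst hg
      exact mem_map.2 ⟨g, mem_filter.2 ⟨mem_univ _, hk⟩, rfl⟩
  refine ⟨A', fun g => ?_, fun i => ?_, fun i j _ => ?_⟩
  · obtain ⟨i, hi⟩ := hcov (p g)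
    refine ⟨i, by simpa [hA'] using hi, fun j hj => hA.disj _ _ _ ?_ hi⟩
    simpa [hA'] using hj
  · exact (hA.le i).trans_eq (hval i _)
  · rcases hA.ef1 i j with h1 | ⟨k, hk, h1⟩
    · left
      rwa [hval i (A j), hval i (A i)] at h1
    · by_cases hkp : ∃ g, p g = k
      · obtain ⟨g, rfl⟩ := hkp
        right
        refine ⟨g, by simpa [hA'] using hk, ?_⟩
        rw [hval i (A i), hval i ((A j).erase (p g))] at h1
        convert h1 using 2
        ext x
        simp [hA', and_comm]
      -- The removed good is a dummy without value, so there was no envy.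
      · left
        push Not at hkp
        have h2 := add_sum_erase _ (fun k : Fin L => w i k) hk
        simp only [hpr i k hkp, zero_add] at h2
        rw [h2, hval i (A j), hval i (A i)] at h1
        exact h1
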